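/- Let $\mathfrak H$ be a complex Hilbert space and let $\alpha\in[0,\pi/2)$. For a linear operator $A$ in $\mathfrak H$ with domain $\operatorname{dom}A$ let $W(A)=\{(Au,u): u\in\operatorname{dom}A,\ \|u\|=1\}$ be its numerical range. An operator $S$ in $\mathfrak H$ is called $m$-accretive if it is densely defined and closed and both $S$ and $S^*$ are accretive, i.e. $\operatorname{Re}(Su,u)\ge 0$ for all $u\in\operatorname{dom}S$ and $\operatorname{Re}(S^*v,v)\ge0$ for all $v\in\operatorname{dom}S^*$; it is called $m$-$\alpha$-sectorial if moreover $W(S)\subseteq\{z\in\mathbb C:|\arg z|\le\alpha\}$ (a set understood to contain $0$). Put $$C(\alpha)=\{z\in\mathbb C: |z|\le 1,\ 2|\operatorname{Im}z|\le(1-|z|^2)\tan\alpha\},\qquad \Omega(\alpha)=\{z^2: z\in C(\alpha)\},$$ $$D_\alpha=\{z\in\mathbb C:|z|\le\sin\alpha\}\cup\{z\in\mathbb C:|\arg(1-z)|\le\alpha,\ |z-1|\le\cos\alpha\}$$ (the second set understood to contain $z=1$). A contraction $C$ on $\mathfrak H$ is called quasi-sectorial with semi-angle $\alpha$ if $W(C)\subseteq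 D_\alpha$. The generator of a $C_0$-semigroup $\{T(t)\}_{t\ge0}$ on $\mathfrak H$ is the operator $Su=\lim_{t\to+0}(u-T(t)u)/t$, defined for all $u$ for which this limit exists; one writes $T(t)=\exp(-tS)$. (1) If $S$ is an $m$-$\alpha$-sectorial operator in $\mathfrak H$, then $-S$ generates a $C_0$-semigroup in the usual sense, i.e. there is a $C_0$-semigroup $\exp(-tS)$ whose generator as defined above is $S$, and $$W(\exp(-tS))\subseteq\Omega(\alpha)\qquad\text{for all }t\ge0.$$ In particular, every $\exp(-tS)$, $t\ge0$, is a quasi-sectorial contraction with semi-angle $\alpha$: $\|\exp(-tS)\|\le1$ and $W(\exp(-tS))\subseteq D_\alpha$. (2) Conversely, let $\{T(t)\}_{t\ge0}$ be a $C_0$-semigroup on $\mathfrak H$ such that for some $\delta>0$ one has $W(T(t))\subseteq\Omega(\alpha)$ for all $t\in[0,\delta)$. Then its generator $S$ is $m$-$\alpha$-sectorial. -/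

import Mathlib

open Filter Topology
open scoped NNReal

/-! ### Numerical ranges -/

/-- The numerical range `W(A) = {(Au, u) : u ∈ dom A, ‖u‖ = 1}` of a (possibly unbounded) linear
operator. Mathlib's inner product is linear in its second argument, so `(Au, u)` is
`inner ℂ u (A u)`. -/
def LinearPMap.numericalRange {H : Type*} [NormedAddCommGroup H] [InnerProductSpace ℂ H]
    (A : H →ₗ.[ℂ] H) : Set ℂ :=
  {z | ∃ u : A.domain, ‖(u : H)‖ = 1 ∧ inner ℂ (u : H) (A u) = z}

/-- The numerical range of a bounded, everywhere defined operator. -/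
def ContinuousLinearMap.numericalRange {H : Type*} [NormedAddCommGroup H]
    [InnerProductSpace ℂ H] (A : H →L[ℂ] H) : Set ℂ :=
  {z | ∃ u : H, ‖u‖ = 1 ∧ inner ℂ u (A u) = z}

/-! ### Subsets of the complex plane -/

/-- The closed sector `{z : |arg z| ≤ α}` with vertex `0` (the vertex belongs to it, as
`Complex.arg 0 = 0`). -/
def sectorSet (α : ℝ) : Set ℂ :=
  {z | |Complex.arg z| ≤ α}

/-- The set `C(α)`. For `0 < α < π/2` it is the intersection of the two closed disks
`|z sin α ± i cos α| ≤ 1` (see `mem_lensSet_iff`); there the condition `‖z‖ ≤ 1` follows from the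
other one. It makes the definition cover `C(0) = [-1, 1]`. -/
def lensSet (α : ℝ) : Set ℂ :=
  {z | ‖z‖ ≤ 1 ∧ 2 * |z.im| ≤ (1 - ‖z‖ ^ 2) * Real.tan α}

/-- The set `Ω(α) = {z² : z ∈ C(α)}`. -/
def omegaSet (α : ℝ) : Set ℂ :=
  (fun z : ℂ => z ^ 2) '' lensSet α

/-- The set `D_α`. -/
def quasiSectorSet (α : ℝ) : Set ℂ :=
  {z | ‖z‖ ≤ Real.sin α} ∪ {z | |Complex.arg (1 - z)| ≤ α ∧ ‖z - 1‖ ≤ Real.cos α}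

theorem mem_lensSet_iff {α : ℝ} (h0 : 0 < α) (h1 : α < Real.pi / 2) (z : ℂ) :
    z ∈ lensSet α ↔
      ‖z * (Real.sin α : ℂ) + Complex.I * (Real.cos α : ℂ)‖ ≤ 1 ∧
      ‖z * (Real.sin α : ℂ) - Complex.I * (Real.cos α : ℂ)‖ ≤ 1 := by
  have hs : 0 < Real.sin α := Real.sin_pos_of_pos_of_lt_pi h0 (by linarith [Real.pi_pos])
  have hc : 0 < Real.cos α := Real.cos_pos_of_mem_Ioo ⟨by linarith, h1⟩
  have hsc := Real.sin_sq_add_cos_sq α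
  have sq_iff : ∀ w : ℂ, ‖w‖ ≤ 1 ↔ w.re ^ 2 + w.im ^ 2 ≤ 1 := by
    intro w
    rw [← sq_le_one_iff₀ (norm_nonneg w), Complex.sq_norm, Complex.normSq_apply]
    ring_nf
  have hz : ‖z‖ ^ 2 = z.re ^ 2 + z.im ^ 2 := by
    rw [Complex.sq_norm, Complex.normSq_apply]; ring
  have key : 2 * |z.im| ≤ (1 - ‖z‖ ^ 2) * Real.tan α ↔
      2 * |z.im| * Real.cos α ≤ (1 - ‖z‖ ^ 2) * Real.sin α := by
    rw [Real.tan_eq_sin_div_cos, ← mul_div_assoc, le_div_iff₀ hc]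
  simp only [lensSet, Set.mem_ofPred_eq]
  rw [key, sq_iff (_ + _), sq_iff (_ - _), hz]
  have e1 : (z * (Real.sin α : ℂ) + Complex.I * (Real.cos α : ℂ)).re = z.re * Real.sin α := by
    simp [-Complex.ofReal_sin, -Complex.ofReal_cos]
  have e2 : (z * (Real.sin α : ℂ) + Complex.I * (Real.cos α : ℂ)).im
      = z.im * Real.sin α + Real.cos α := by
    simp [-Complex.ofReal_sin, -Complex.ofReal_cos]
  have e3 : (z * (Real.sin α : ℂ) - Complex.I * (Real.cos α : ℂ)).re = z.re * Real.sin α := by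
    simp [-Complex.ofReal_sin, -Complex.ofReal_cos]
  have e4 : (z * (Real.sin α : ℂ) - Complex.I * (Real.cos α : ℂ)).im
      = z.im * Real.sin α - Real.cos α := by
    simp [-Complex.ofReal_sin, -Complex.ofReal_cos]
  rw [e1, e2, e3, e4]
  have f1 : (z.re * Real.sin α) ^ 2 + (z.im * Real.sin α + Real.cos α) ^ 2 - 1
      = Real.sin α * (2 * z.im * Real.cos α - (1 - (z.re ^ 2 + z.im ^ 2)) * Real.sin α) := by
    linear_combination hsc
  have f2 : (z.re * Real.sin α) ^ 2 + (z.im * Real.sin α - Real.cos α) ^ 2 - 1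
      = Real.sin α * (-2 * z.im * Real.cos α - (1 - (z.re ^ 2 + z.im ^ 2)) * Real.sin α) := by
    linear_combination hsc
  constructor
  · rintro ⟨-, h⟩
    have a1 : z.im * Real.cos α ≤ |z.im| * Real.cos α :=
      mul_le_mul_of_nonneg_right (le_abs_self _) hc.le
    have a2 : -z.im * Real.cos α ≤ |z.im| * Real.cos α :=
      mul_le_mul_of_nonneg_right (neg_le_abs _) hc.le
    constructor
    · have := mul_nonneg hs.le (sub_nonneg.2 (show 2 * z.im * Real.cos α ≤
        (1 - (z.re ^ 2 + z.im ^ 2)) * Real.sin α by linarith))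
      linarith
    · have := mul_nonneg hs.le (sub_nonneg.2 (show -2 * z.im * Real.cos α ≤
        (1 - (z.re ^ 2 + z.im ^ 2)) * Real.sin α by linarith))
      linarith
  · rintro ⟨g1, g2⟩
    have b1 : 2 * z.im * Real.cos α - (1 - (z.re ^ 2 + z.im ^ 2)) * Real.sin α ≤ 0 := by
      by_contra hh
      have := mul_pos hs (not_le.1 hh)
      linarith
    have b2 : -2 * z.im * Real.cos α - (1 - (z.re ^ 2 + z.im ^ 2)) * Real.sin α ≤ 0 := by
      by_contra hh
      have := mul_pos hs (not_le.1 hh)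
      linarith
    have b3 : 2 * |z.im| * Real.cos α ≤ (1 - (z.re ^ 2 + z.im ^ 2)) * Real.sin α := by
      rcases abs_cases z.im with ⟨h, -⟩ | ⟨h, -⟩ <;> rw [h] <;> linarith
    refine ⟨?_, b3⟩
    have b4 : 0 ≤ 2 * |z.im| * Real.cos α := by positivity
    have b5 : 0 ≤ 1 - (z.re ^ 2 + z.im ^ 2) := by
      by_contra hh
      have := mul_neg_of_neg_of_pos (not_le.1 hh) hs
      linarith
    rw [← sq_le_one_iff₀ (norm_nonneg z), hz]
    linarith

/-! ### Accretive and sectorial operators, quasi-sectorial contractions -/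

/-- `S` is accretive: `Re (Su, u) ≥ 0` for all `u ∈ dom S`. -/
def LinearPMap.IsAccretive {H : Type*} [NormedAddCommGroup H] [InnerProductSpace ℂ H]
    (S : H →ₗ.[ℂ] H) : Prop :=
  ∀ u : S.domain, 0 ≤ (inner ℂ (u : H) (S u)).re

/-- `S` is `m`-accretive: it is accretive, densely defined and closed, and its adjoint is
accretive. -/
structure LinearPMap.IsMAccretive {H : Type*} [NormedAddCommGroup H] [InnerProductSpace ℂ H]
    [CompleteSpace H] (S : H →ₗ.[ℂ] H) : Prop where
  accretive : S.IsAccretive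
  dense_domain : Dense (S.domain : Set H)
  closed : S.IsClosed
  adjoint_accretive : S.adjoint.IsAccretive

/-- `S` is `m`-`α`-sectorial: it is `m`-accretive, and its numerical range lies in the sector with
vertex `0` and semi-angle `α`. -/
structure LinearPMap.IsMSectorial {H : Type*} [NormedAddCommGroup H] [InnerProductSpace ℂ H]
    [CompleteSpace H] (α : ℝ) (S : H →ₗ.[ℂ] H) : Prop where
  mAccretive : S.IsMAccretive
  numericalRange_subset : S.numericalRange ⊆ sectorSet α

/-- A quasi-sectorial contraction with semi-angle `α`: a contraction whose numerical range lies in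
`D_α`. -/
structure ContinuousLinearMap.IsQuasiSectorialContraction {H : Type*} [NormedAddCommGroup H]
    [InnerProductSpace ℂ H] (α : ℝ) (C : H →L[ℂ] H) : Prop where
  norm_le_one : ‖C‖ ≤ 1
  numericalRange_subset : C.numericalRange ⊆ quasiSectorSet α

/-! ### Strongly continuous semigroups and their generators -/

/-- A `C₀`-semigroup: a strongly continuous one-parameter semigroup `(T(t))_{t ≥ 0}` of bounded
operators with `T(0) = I`. -/
structure C0Semigroup (H : Type*) [NormedAddCommGroup H] [InnerProductSpace ℂ H] where
  toFun : ℝ≥0 → H →L[ℂ] H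
  map_zero : toFun 0 = ContinuousLinearMap.id ℂ H
  map_add : ∀ s t : ℝ≥0, toFun (s + t) = (toFun s).comp (toFun t)
  strongly_continuous : ∀ u : H, Continuous fun t : ℝ≥0 => toFun t u

/-- `u` belongs to the domain of the generator of `T` and its image is `v`:
`(u - T(t) u) / t → v` as `t → 0+`. -/
def C0Semigroup.HasGeneratorAt {H : Type*} [NormedAddCommGroup H] [InnerProductSpace ℂ H]
    (T : C0Semigroup H) (u v : H) : Prop :=
  Tendsto (fun t : ℝ≥0 => ((t : ℝ) : ℂ)⁻¹ • (u - T.toFun t u)) (𝓝[>] 0) (𝓝 v)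

theorem C0Semigroup.HasGeneratorAt.unique {H : Type*} [NormedAddCommGroup H]
    [InnerProductSpace ℂ H] {T : C0Semigroup H} {u v w : H} (hv : T.HasGeneratorAt u v)
    (hw : T.HasGeneratorAt u w) : v = w :=
  tendsto_nhds_unique hv hw

theorem C0Semigroup.HasGeneratorAt.add {H : Type*} [NormedAddCommGroup H]
    [InnerProductSpace ℂ H] {T : C0Semigroup H} {u v u' v' : H} (h : T.HasGeneratorAt u v)
    (h' : T.HasGeneratorAt u' v') : T.HasGeneratorAt (u + u') (v + v') := by
  refine (Tendsto.add h h').congr fun t => ?_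
  rw [← smul_add, _root_.map_add]
  congr 1
  abel

theorem C0Semigroup.HasGeneratorAt.smul {H : Type*} [NormedAddCommGroup H]
    [InnerProductSpace ℂ H] {T : C0Semigroup H} {u v : H} (c : ℂ) (h : T.HasGeneratorAt u v) :
    T.HasGeneratorAt (c • u) (c • v) := by
  refine (Tendsto.const_smul h c).congr fun t => ?_
  rw [map_smul, ← smul_sub, smul_comm]

/-- The generator `S` of `T(t) = exp(-tS)`: the operator `S u = lim_{t → 0+} (u - T(t) u) / t`,
whose domain consists of all `u` for which this limit exists. -/
noncomputable def C0Semigroup.generator {H : Type*} [NormedAddCommGroup H]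
    [InnerProductSpace ℂ H] (T : C0Semigroup H) : H →ₗ.[ℂ] H where
  domain :=
    { carrier := {u | ∃ v, T.HasGeneratorAt u v}
      zero_mem' := ⟨0, by simp [C0Semigroup.HasGeneratorAt]⟩
      add_mem' := fun ⟨v, hv⟩ ⟨w, hw⟩ => ⟨v + w, hv.add hw⟩
      smul_mem' := fun c _ ⟨v, hv⟩ => ⟨c • v, hv.smul c⟩ }
  toFun :=
    { toFun := fun u => u.2.choose
      map_add' := fun u w =>
        (u + w).2.choose_spec.unique (u.2.choose_spec.add w.2.choose_spec)
      map_smul' := fun c u => (c • u).2.choose_spec.unique (u.2.choose_spec.smul c) }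

theorem C0Semigroup.generator_spec {H : Type*} [NormedAddCommGroup H] [InnerProductSpace ℂ H]
    (T : C0Semigroup H) (u : T.generator.domain) :
    T.HasGeneratorAt (u : H) (T.generator u) :=
  u.2.choose_spec

/-! ### The regions in the complex plane -/

/-! Write `k = tan α`. Sectoriality of `S` says `|Im (Su, u)| ≤ k Re (Su, u)`, and polarization
extends this to the cross terms of two vectors. For `u` in the domain and `r ≥ 0`, compare the orbit
with its time reversal about `r / 2`: with `φ(s) = T(s)u`, the function `k (‖φ(s)‖² - ‖φ(r - s)‖²) ±
2 Im (φ(s), φ(r - s))` vanishes at `s = r / 2`, and the polarized inequality makes it nonincreasing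
on `[0, r / 2]`. Its value at `0` is therefore nonnegative, which is `2 |Im (T(r)u, u)| ≤ k (‖u‖² -
‖T(r)u‖²)` (`two_mul_abs_im_inner_le`). By Cauchy–Schwarz, `W(T(r)) ⊆ C(α)` for every `r`.

The set `C(α)` is closed, convex and symmetric about `0`. For such a set `K`, `W(A) ⊆ K` implies
that `W(A²)` consists of squares of points of `K` (`mem_of_sq_eq_inner_sq`). Applied to `A =
T(t/2)`, this gives `W(T(t)) ⊆ Ω(α)`; the inclusion `Ω(α) ⊆ D_α` is plane geometry.

Existence of the semigroup is the Hille–Yosida theorem, proved with Yosida approximations.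

Conversely, `Ω(α)` lies in the unit disk and in the sector with vertex `1` opening to the left.
Hence `((I - T(t))u, u) / t` lies in the sector with vertex `0` for small `t > 0`, and so does its
limit `(Su, u)`. Density and closedness of the generator are standard, and accretivity of `S*`
follows by testing against time averages of orbits. -/

/-- The form linear in `z.re` and `|z.im|` is the one that survives scaling, polarization and
limits. -/
theorem mem_sectorSet_iff {α : ℝ} (h0 : 0 ≤ α) (h1 : α < Real.pi / 2) (z : ℂ) :
    z ∈ sectorSet α ↔ 0 ≤ z.re ∧ |z.im| ≤ Real.tan α * z.re := by
  have hpi := Real.pi_pos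
  change |Complex.arg z| ≤ α ↔ _
  have ht : 0 ≤ Real.tan α := Real.tan_nonneg_of_nonneg_of_le_pi_div_two h0 h1.le
  rcases eq_or_ne z 0 with rfl | hz
  · simpa using h0
  have mono : 0 < z.re → |Complex.arg z| < Real.pi / 2 →
      (|Complex.arg z| ≤ α ↔ |z.im| ≤ Real.tan α * z.re) := by
    intro hre harg
    have e : Real.tan |Complex.arg z| = |z.im| / z.re := by
      have := Complex.tan_arg z
      rcases abs_cases (Complex.arg z) with ⟨h, h'⟩ | ⟨h, h'⟩
      · rw [h, this, abs_of_nonneg (Complex.arg_nonneg_iff.1 h')]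
      · rw [h, Real.tan_neg, this, abs_of_neg (Complex.arg_neg_iff.1 h'), neg_div]
    rw [← div_le_iff₀ hre, ← e]
    exact (Real.strictMonoOn_tan.le_iff_le ⟨by linarith [abs_nonneg (Complex.arg z)], harg⟩
      ⟨by linarith, h1⟩).symm
  constructor
  · intro h
    have harg := h.trans_lt h1
    rcases Complex.abs_arg_lt_pi_div_two_iff.1 harg with hre | h'
    · exact ⟨hre.le, (mono hre harg).1 h⟩
    · exact absurd h' hz
  · rintro ⟨hre, him⟩
    rcases hre.eq_or_lt with hre | hre
    · rw [← hre, mul_zero, abs_nonpos_iff] at him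
      exact absurd (Complex.ext hre.symm him) hz
    · have harg := Complex.abs_arg_lt_pi_div_two_iff.2 (Or.inl hre)
      exact (mono hre harg).2 him

theorem neg_mem_lensSet {α : ℝ} {z : ℂ} (hz : z ∈ lensSet α) : -z ∈ lensSet α := by
  simpa [lensSet] using hz

theorem isClosed_lensSet (α : ℝ) : IsClosed (lensSet α) := by
  have e : lensSet α =
      {z | ‖z‖ ≤ 1} ∩ {z | 2 * |z.im| ≤ (1 - ‖z‖ ^ 2) * Real.tan α} := rfl
  rw [e]
  exact (isClosed_le (by fun_prop) (by fun_prop)).inter (isClosed_le (by fun_prop) (by fun_prop))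

theorem convex_lensSet {α : ℝ} (h0 : 0 ≤ α) (h1 : α < Real.pi / 2) :
    Convex ℝ (lensSet α) := by
  have ht : 0 ≤ Real.tan α := Real.tan_nonneg_of_nonneg_of_le_pi_div_two h0 h1.le
  intro z hz w hw a b ha hb hab
  have hn : ‖a • z + b • w‖ ≤ a * ‖z‖ + b * ‖w‖ := by
    refine (norm_add_le _ _).trans (le_of_eq ?_)
    rw [norm_smul, norm_smul, Real.norm_of_nonneg ha, Real.norm_of_nonneg hb]
  have hi : |(a • z + b • w).im| ≤ a * |z.im| + b * |w.im| := by
    refine (abs_add_le _ _).trans (le_of_eq ?_)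
    simp [abs_mul, abs_of_nonneg ha, abs_of_nonneg hb]
  have hsq : ‖a • z + b • w‖ ^ 2 ≤ a * ‖z‖ ^ 2 + b * ‖w‖ ^ 2 := by
    refine (pow_le_pow_left₀ (norm_nonneg _) hn 2).trans ?_
    obtain rfl : b = 1 - a := by linarith
    nlinarith [mul_nonneg (mul_nonneg ha hb) (sq_nonneg (‖z‖ - ‖w‖))]
  refine ⟨hn.trans ?_, ?_⟩
  · nlinarith [mul_le_mul_of_nonneg_left hz.1 ha, mul_le_mul_of_nonneg_left hw.1 hb]
  · have e1 := mul_le_mul_of_nonneg_left hz.2 ha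
    have e2 := mul_le_mul_of_nonneg_left hw.2 hb
    have e3 := mul_le_mul_of_nonneg_right hsq ht
    have e4 : a * Real.tan α + b * Real.tan α = Real.tan α := by rw [← add_mul, hab, one_mul]
    linarith

theorem norm_le_one_of_mem_omegaSet {α : ℝ} {w : ℂ} (hw : w ∈ omegaSet α) : ‖w‖ ≤ 1 := by
  obtain ⟨z, hz, rfl⟩ := hw
  simpa only [norm_pow] using pow_le_one₀ (n := 2) (norm_nonneg z) hz.1

/-- For `w = (x + iy)²` with `|x| ≤ 1`: `|Im w| = 2|xy| ≤ 2|y| ≤ k (1 - x² - y²) ≤ k (1 - x² + y²) =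
k (1 - Re w)`, where `k = tan α`. -/
theorem abs_im_le_of_mem_omegaSet {α : ℝ} (h0 : 0 ≤ α) (h1 : α < Real.pi / 2) {w : ℂ}
    (hw : w ∈ omegaSet α) : |w.im| ≤ Real.tan α * (1 - w.re) := by
  have ht : 0 ≤ Real.tan α := Real.tan_nonneg_of_nonneg_of_le_pi_div_two h0 h1.le
  obtain ⟨z, hz, rfl⟩ := hw
  have hn : ‖z‖ ^ 2 = z.re ^ 2 + z.im ^ 2 := by
    rw [Complex.sq_norm, Complex.normSq_apply]; ring
  have h2 := hz.2
  have hre : |z.re| ≤ 1 := (Complex.abs_re_le_norm z).trans hz.1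
  have e1 : (z ^ 2).im = 2 * (z.re * z.im) := by simp [pow_two]; ring
  have e2 : (z ^ 2).re = z.re ^ 2 - z.im ^ 2 := by simp [pow_two]
  simp only [e1, e2, abs_mul, abs_two]
  rw [hn] at h2
  nlinarith [mul_le_mul_of_nonneg_right hre (abs_nonneg z.im), mul_nonneg ht (sq_nonneg z.im)]

/-- Near `1` the sector bound applies. Otherwise, the identity `|z² - 1|² = (1 - |z|²)² + 4 (Im z)²`
and the inequality defining `C(α)` give `|z² - 1| cos α ≤ 1 - |z|²`, so `|z² - 1| > cos α` forces
`|z|² ≤ 1 - cos² α = sin² α ≤ sin α`. -/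
theorem omegaSet_subset_quasiSectorSet {α : ℝ} (h0 : 0 ≤ α) (h1 : α < Real.pi / 2) :
    omegaSet α ⊆ quasiSectorSet α := by
  intro w hw
  have hc : 0 < Real.cos α := Real.cos_pos_of_mem_Ioo ⟨by linarith, h1⟩
  have hs : 0 ≤ Real.sin α := Real.sin_nonneg_of_nonneg_of_le_pi h0 (by linarith [Real.pi_pos])
  have hs1 := Real.sin_le_one α
  have hsc := Real.sin_sq_add_cos_sq α
  have h := abs_im_le_of_mem_omegaSet h0 h1 hw
  have hw1 := norm_le_one_of_mem_omegaSet hw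
  by_cases hd : ‖w - 1‖ ≤ Real.cos α
  · refine Or.inr ⟨?_, hd⟩
    refine (mem_sectorSet_iff h0 h1 _).2 ⟨?_, by simpa using h⟩
    have := (Complex.re_le_norm w).trans hw1
    simpa using this
  · refine Or.inl ?_
    change ‖w‖ ≤ _
    push Not at hd
    obtain ⟨z, hz, rfl⟩ := hw
    have hn : ‖z‖ ^ 2 = z.re ^ 2 + z.im ^ 2 := by
      rw [Complex.sq_norm, Complex.normSq_apply]; ring
    have hz2 : 2 * |z.im| * Real.cos α ≤ (1 - ‖z‖ ^ 2) * Real.sin α := by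
      have := hz.2
      rwa [Real.tan_eq_sin_div_cos, ← mul_div_assoc, le_div_iff₀ hc] at this
    have hr : 0 ≤ 1 - ‖z‖ ^ 2 := sub_nonneg.2 (pow_le_one₀ (norm_nonneg z) hz.1)
    have hsq := pow_le_pow_left₀ (by positivity) hz2 2
    rw [mul_pow, mul_pow, mul_pow, sq_abs] at hsq
    have e : ‖z ^ 2 - 1‖ ^ 2 = (1 - ‖z‖ ^ 2) ^ 2 + 4 * z.im ^ 2 := by
      rw [hn, Complex.sq_norm, Complex.normSq_apply]
      simp [pow_two]
      ring
    have hd2 : ‖z ^ 2 - 1‖ * Real.cos α ≤ 1 - ‖z‖ ^ 2 := by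
      refine (sq_le_sq₀ (by positivity) hr).1 ?_
      rw [mul_pow, e]
      have : Real.sin α ^ 2 = 1 - Real.cos α ^ 2 := by linarith
      rw [this] at hsq
      linarith
    have hlt := mul_lt_mul_of_pos_right hd hc
    simp only [norm_pow]
    nlinarith

/-! ### The numerical range of a square -/

section Square

variable {H : Type*} [NormedAddCommGroup H] [InnerProductSpace ℂ H]

/-- Take `v = Au / ‖Au‖`. By symmetry `4 ‖Au‖ = (A(u+v), u+v) - (A(u-v), u-v)` up to real parts,
which is at most `c (‖u+v‖² + ‖u-v‖²) = 4c` by the parallelogram law. -/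
theorem ContinuousLinearMap.norm_le_of_isSymmetric_of_abs_re_inner_le {A : H →L[ℂ] H} {c : ℝ}
    (hA : (A : H →ₗ[ℂ] H).IsSymmetric) (h : ∀ u, |(inner ℂ u (A u)).re| ≤ c * ‖u‖ ^ 2)
    {u : H} (hu : ‖u‖ = 1) : ‖A u‖ ≤ c := by
  rcases eq_or_ne (A u) 0 with h0 | h0
  · rw [h0, norm_zero]
    simpa [hu] using (abs_nonneg _).trans (h u)
  have hp : 0 < ‖A u‖ := norm_pos_iff.2 h0
  set v : H := ((‖A u‖⁻¹ : ℝ) : ℂ) • A u with hv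
  have hv1 : ‖v‖ = 1 := by simp [hv, norm_smul, hp.ne']
  have hin : (inner ℂ v (A u)).re = ‖A u‖ := by
    rw [hv, inner_smul_left, inner_self_eq_norm_sq_to_K]
    simp only [Complex.conj_ofReal, Complex.coe_algebraMap]
    norm_cast
    field_simp
  have hin' : (inner ℂ u (A v)).re = ‖A u‖ := by
    rw [← hin, ← inner_conj_symm v, Complex.conj_re]
    exact congrArg Complex.re (hA u v).symm
  have e1 := (le_abs_self _).trans (h (u + v))
  have e2 := (neg_le_abs _).trans (h (u - v))
  have e3 := parallelogram_law_with_norm ℂ u v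
  simp only [_root_.map_add, _root_.map_sub, inner_add_left, inner_add_right, inner_sub_left,
    inner_sub_right, Complex.add_re, Complex.sub_re, hin, hin'] at e1 e2
  rw [hu, hv1] at e3
  have : c * ‖u + v‖ ^ 2 + c * ‖u - v‖ ^ 2 = 4 * c := by
    linear_combination c * e3
  linarith

/-- The strip case of the mapping theorem. Split `M = A + iB` with `A`, `B` self-adjoint and put `p
= Au`, `q = Bu`; then `‖p‖ ≤ c`. Since `(M²u, u) = (Mu, M*u)`, comparing real and imaginary parts
gives `x² - y² = ‖p‖² - ‖q‖²` and `|xy| ≤ ‖p‖ ‖q‖` for `z = x + iy`. -/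
theorem ContinuousLinearMap.abs_re_le_of_sq_eq_inner_sq [CompleteSpace H] {M : H →L[ℂ] H} {c : ℝ}
    (h : ∀ u, |(inner ℂ u (M u)).re| ≤ c * ‖u‖ ^ 2) {u : H} (hu : ‖u‖ = 1) {z : ℂ}
    (hz : z ^ 2 = inner ℂ u (M (M u))) : |z.re| ≤ c := by
  have hre : ∀ x, (inner ℂ x (M.adjoint x)).re = (inner ℂ x (M x)).re := fun x => by
    rw [M.adjoint_inner_right, ← inner_conj_symm, Complex.conj_re]
  set A : H →L[ℂ] H := (2⁻¹ : ℂ) • (M + M.adjoint) with hA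
  set p := A u with hp
  set q : H := (-(2⁻¹ : ℂ) * Complex.I) • (M u - M.adjoint u) with hq
  have hsymm : (A : H →ₗ[ℂ] H).IsSymmetric := by
    intro x y
    simp [hA, inner_smul_left, inner_smul_right, inner_add_left, inner_add_right,
      M.adjoint_inner_left, M.adjoint_inner_right, map_ofNat]
    ring
  have hpc : ‖p‖ ≤ c := by
    refine A.norm_le_of_isSymmetric_of_abs_re_inner_le hsymm (fun x => ?_) hu
    have : (inner ℂ x (A x)).re = (inner ℂ x (M x)).re := by
      have e : inner ℂ x (A x) = ((2⁻¹ : ℝ) : ℂ) * (inner ℂ x (M x) + inner ℂ x (M.adjoint x)) := by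
        simp [hA, mul_add]
      rw [e, Complex.re_ofReal_mul, Complex.add_re, hre]
      ring
    rw [this]
    exact h x
  have hM : M u = p + Complex.I • q := by
    simp only [hp, hq, hA, smul_apply, add_apply, smul_smul]
    rw [show Complex.I * (-(2⁻¹ : ℂ) * Complex.I) = 2⁻¹ by
      linear_combination (-(2⁻¹ : ℂ)) * Complex.I_mul_I]
    module
  have hM' : M.adjoint u = p - Complex.I • q := by
    simp only [hp, hq, hA, smul_apply, add_apply, smul_smul]
    rw [show Complex.I * (-(2⁻¹ : ℂ) * Complex.I) = 2⁻¹ by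
      linear_combination (-(2⁻¹ : ℂ)) * Complex.I_mul_I]
    module
  have key : inner ℂ u (M (M u)) = (‖p‖ : ℂ) ^ 2 - (‖q‖ : ℂ) ^ 2
      + Complex.I * (inner ℂ p q + inner ℂ q p) := by
    rw [← M.adjoint_inner_left, hM, hM']
    simp only [inner_sub_left, inner_add_right, inner_smul_left, inner_smul_right,
      inner_self_eq_norm_sq_to_K, Complex.conj_I, Complex.coe_algebraMap]
    linear_combination ((‖q‖ : ℂ) ^ 2) * Complex.I_mul_I
  have hpq : inner ℂ p q + inner ℂ q p = ((2 * (inner ℂ p q).re : ℝ) : ℂ) := by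
    rw [← inner_conj_symm q p, Complex.add_conj]
  rw [key, hpq] at hz
  have e1 : z.re ^ 2 - z.im ^ 2 = ‖p‖ ^ 2 - ‖q‖ ^ 2 := by
    have := congrArg Complex.re hz
    simpa [pow_two] using this
  have e2 : z.re * z.im = (inner ℂ p q).re := by
    have := congrArg Complex.im hz
    simp [pow_two] at this
    linarith
  have e3 : |(inner ℂ p q).re| ≤ ‖p‖ * ‖q‖ :=
    (Complex.abs_re_le_norm _).trans (norm_inner_le_norm p q)
  have e4 : (z.re * z.im) ^ 2 ≤ (‖p‖ * ‖q‖) ^ 2 := by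
    rw [e2, ← sq_abs]
    exact pow_le_pow_left₀ (abs_nonneg _) e3 2
  have hc : 0 ≤ c := (norm_nonneg p).trans hpc
  have hpc2 : ‖p‖ ^ 2 ≤ c ^ 2 := pow_le_pow_left₀ (norm_nonneg p) hpc 2
  -- If `|x| > c ≥ ‖p‖`, then the difference identity gives `y² > ‖q‖²`, so `|xy| > ‖p‖ ‖q‖`, a
  -- contradiction.
  by_contra! hlt
  have hx : c ^ 2 < z.re ^ 2 := by
    rw [← sq_abs z.re]
    exact pow_lt_pow_left₀ hlt hc two_ne_zero
  have hy : ‖q‖ ^ 2 < z.im ^ 2 := by linarith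
  have := mul_lt_mul'' (hpc2.trans_lt hx) hy (sq_nonneg _) (sq_nonneg _)
  rw [← mul_pow, ← mul_pow] at this
  linarith

/-- A case of Kato's mapping theorem for the numerical range: if `W(T)` lies in a closed convex
set symmetric about `0`, then `W(T²)` lies in the set of squares. -/
theorem ContinuousLinearMap.mem_of_sq_eq_inner_sq [CompleteSpace H] {T : H →L[ℂ] H} {K : Set ℂ}
    (hcl : IsClosed K) (hcv : Convex ℝ K) (hneg : ∀ z ∈ K, -z ∈ K)
    (h : T.numericalRange ⊆ K) {u : H} (hu : ‖u‖ = 1) {z : ℂ}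
    (hz : z ^ 2 = inner ℂ u (T (T u))) : z ∈ K := by
  by_contra hzK
  -- A separating real functional has the form `w ↦ Re (n w)`. By the symmetry of `K` it bounds `|Re
  -- (n w)|` on `W(T)`, so the strip case applies to `n • T` and the root `n * z`.
  obtain ⟨f, c, hf, hc⟩ := geometric_hahn_banach_closed_point hcv hcl hzK
  set n : ℂ := ⟨f 1, -f Complex.I⟩ with hn
  have hfn : ∀ w, f w = (n * w).re := fun w => by
    have e : w = w.re • (1 : ℂ) + w.im • Complex.I := by
      apply Complex.ext <;> simp
    conv_lhs => rw [e]
    rw [_root_.map_add, map_smul, map_smul]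
    simp [hn]
    ring
  have hunit : ∀ v : H, ‖v‖ = 1 → |(inner ℂ v ((n • T) v)).re| ≤ c := fun v hv => by
    have hv' := h ⟨v, hv, rfl⟩
    have e : (inner ℂ v ((n • T) v)).re = f (inner ℂ v (T v)) := by
      rw [hfn, smul_apply, inner_smul_right]
    rw [e, abs_le]
    have h1 := hf _ hv'
    have h2 := hf _ (hneg _ hv')
    rw [map_neg] at h2
    constructor <;> linarith
  have hall : ∀ v : H, |(inner ℂ v ((n • T) v)).re| ≤ c * ‖v‖ ^ 2 := fun v => by
    rcases eq_or_ne v 0 with rfl | hv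
    · simp
    have hv0 : 0 < ‖v‖ := norm_pos_iff.2 hv
    have h1 := hunit (((‖v‖⁻¹ : ℝ) : ℂ) • v) (by simp [norm_smul, hv0.ne'])
    rw [map_smul, inner_smul_left, inner_smul_right, Complex.conj_ofReal, ← mul_assoc,
      ← Complex.ofReal_mul, Complex.re_ofReal_mul, abs_mul, abs_of_nonneg (by positivity),
      ← mul_inv, ← pow_two, inv_mul_le_iff₀ (by positivity)] at h1
    linarith
  have := (le_abs_self _).trans (abs_re_le_of_sq_eq_inner_sq hall hu (z := n * z) (by
    rw [mul_pow, hz]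
    simp only [smul_apply, map_smul, inner_smul_right]
    ring))
  rw [← hfn] at this
  linarith

theorem ContinuousLinearMap.numericalRange_comp_self_subset_omegaSet [CompleteSpace H] {α : ℝ}
    (h0 : 0 ≤ α) (h1 : α < Real.pi / 2) {T : H →L[ℂ] H} (h : T.numericalRange ⊆ lensSet α) :
    (T.comp T).numericalRange ⊆ omegaSet α := by
  rintro w ⟨u, hu, rfl⟩
  obtain ⟨z, hz⟩ := IsAlgClosed.exists_pow_nat_eq (inner ℂ u (T (T u))) two_pos
  exact ⟨z, mem_of_sq_eq_inner_sq (isClosed_lensSet α) (convex_lensSet h0 h1)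
    (fun _ => neg_mem_lensSet) h hu hz, hz⟩

end Square

/-! ### Orbits and generators of `C₀`-semigroups -/

namespace C0Semigroup

variable {H : Type*} [NormedAddCommGroup H] [InnerProductSpace ℂ H]

/-- The orbit `s ↦ T(s) u`, extended to negative times by the constant `u`. -/
def orbit (T : C0Semigroup H) (u : H) (s : ℝ) : H := T.toFun s.toNNReal u

theorem continuous_orbit (T : C0Semigroup H) (u : H) : Continuous (T.orbit u) :=
  (T.strongly_continuous u).comp continuous_real_toNNReal

@[simp] theorem orbit_zero (T : C0Semigroup H) (u : H) : T.orbit u 0 = u := by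
  simp [orbit, T.map_zero]

@[simp] theorem orbit_coe (T : C0Semigroup H) (u : H) (t : ℝ≥0) : T.orbit u t = T.toFun t u := by
  simp [orbit]

theorem orbit_add (T : C0Semigroup H) (u : H) {s t : ℝ} (hs : 0 ≤ s) (ht : 0 ≤ t) :
    T.orbit u (s + t) = T.toFun s.toNNReal (T.orbit u t) := by
  simp [orbit, Real.toNNReal_add hs ht, T.map_add]

/-- Makes one-variable calculus on `ℝ` available. Only the right derivative is meant: to the left of
`0` the orbit is constant. -/
theorem hasGeneratorAt_iff {T : C0Semigroup H} {u v : H} :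
    T.HasGeneratorAt u v ↔ HasDerivWithinAt (T.orbit u) (-v) (Set.Ioi 0) 0 := by
  rw [hasDerivWithinAt_iff_tendsto_slope' Set.self_notMem_Ioi]
  have e : ∀ t : ℝ≥0, slope (T.orbit u) 0 t = -(((t : ℝ) : ℂ)⁻¹ • (u - T.toFun t u)) := fun t => by
    rw [slope_def_module, orbit_zero, orbit_coe, sub_zero, ← smul_neg, neg_sub,
      ← Complex.ofReal_inv, Complex.coe_smul]
  constructor
  · intro h
    have hr : Tendsto Real.toNNReal (𝓝[>] 0) (𝓝[>] 0) := by
      refine tendsto_nhdsWithin_of_tendsto_nhds_of_eventually_within _ ?_ ?_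
      · have := (continuous_real_toNNReal.tendsto (0 : ℝ)).mono_left
          (nhdsWithin_le_nhds (s := Set.Ioi 0))
        simpa using this
      · filter_upwards [self_mem_nhdsWithin] with x hx
        exact Real.toNNReal_pos.2 hx
    refine (h.neg.comp hr).congr' ?_
    filter_upwards [self_mem_nhdsWithin] with x hx
    rw [Function.comp_apply, ← e, Real.coe_toNNReal _ (le_of_lt hx)]
  · intro h
    have hc : Tendsto (fun t : ℝ≥0 => (t : ℝ)) (𝓝[>] 0) (𝓝[>] 0) := by
      refine tendsto_nhdsWithin_of_tendsto_nhds_of_eventually_within _ ?_ ?_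
      · exact (NNReal.continuous_coe.tendsto 0).mono_left nhdsWithin_le_nhds
      · filter_upwards [self_mem_nhdsWithin] with x hx
        exact NNReal.coe_pos.2 hx
    refine ((h.comp hc).neg.congr fun t => ?_).trans (by rw [neg_neg])
    rw [Function.comp_apply, e, neg_neg]

theorem mem_generator_domain {T : C0Semigroup H} {u v : H} (h : T.HasGeneratorAt u v) :
    u ∈ T.generator.domain :=
  ⟨v, h⟩

theorem generator_apply_eq {T : C0Semigroup H} {u v : H} (h : T.HasGeneratorAt u v)
    (hu : u ∈ T.generator.domain) : T.generator ⟨u, hu⟩ = v :=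
  (T.generator_spec ⟨u, hu⟩).unique h

theorem HasGeneratorAt.map {T : C0Semigroup H} {u v : H} (h : T.HasGeneratorAt u v) (s : ℝ≥0) :
    T.HasGeneratorAt (T.toFun s u) (T.toFun s v) := by
  refine (((T.toFun s).continuous.tendsto v).comp h).congr fun t => ?_
  rw [Function.comp_apply, map_smul, _root_.map_sub]
  congr 2
  rw [← ContinuousLinearMap.comp_apply, ← ContinuousLinearMap.comp_apply, ← T.map_add,
    ← T.map_add, add_comm]

theorem HasGeneratorAt.hasDerivWithinAt_orbit {T : C0Semigroup H} {u v : H}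
    (h : T.HasGeneratorAt u v) {s : ℝ} (hs : 0 ≤ s) :
    HasDerivWithinAt (T.orbit u) (-T.orbit v s) (Set.Ioi s) s := by
  have h0 : HasDerivWithinAt (fun r : ℝ => r - s) 1 (Set.Ioi s) s :=
    ((hasDerivAt_id s).sub_const s).hasDerivWithinAt
  have h1 : HasDerivWithinAt (fun r => T.orbit u (r - s)) (-v) (Set.Ioi s) s := by
    have := (hasGeneratorAt_iff.1 h).scomp_of_eq s h0 (fun r hr => Set.mem_Ioi.2 (sub_pos.2 hr))
      (sub_self s).symm
    simpa [Function.comp_def] using this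
  have h2 := ((T.toFun s.toNNReal).restrictScalars ℝ).hasFDerivAt.comp_hasDerivWithinAt s h1
  simp only [Function.comp_def, ContinuousLinearMap.coe_restrictScalars', map_neg] at h2
  refine h2.congr (fun r hr => ?_) ?_
  · rw [← T.orbit_add u hs (sub_nonneg.2 (le_of_lt hr)), add_sub_cancel]
  · rw [← T.orbit_add u hs (sub_self s).ge, add_sub_cancel]

variable [CompleteSpace H]

theorem hasDerivAt_integral_orbit (T : C0Semigroup H) (u : H) (t : ℝ) :
    HasDerivAt (fun r => ∫ s in (0 : ℝ)..r, T.orbit u s) (T.orbit u t) t :=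
  ((T.continuous_orbit u).integral_hasStrictDerivAt 0 t).hasDerivAt

/-- By the semigroup law, applying `T(h)` to the integral over `[0, t]` gives the integral over `[h,
t + h]`, a difference of two primitives that can be differentiated at `h = 0`. -/
theorem hasGeneratorAt_integral_orbit (T : C0Semigroup H) (u : H) {t : ℝ} (ht : 0 ≤ t) :
    T.HasGeneratorAt (∫ s in (0 : ℝ)..t, T.orbit u s) (u - T.orbit u t) := by
  have hint : ∀ a b, IntervalIntegrable (T.orbit u) MeasureTheory.volume a b :=
    fun a b => (T.continuous_orbit u).intervalIntegrable a b
  have key : ∀ h : ℝ, 0 ≤ h → T.orbit (∫ s in (0 : ℝ)..t, T.orbit u s) h =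
      (∫ s in (0 : ℝ)..(t + h), T.orbit u s) - ∫ s in (0 : ℝ)..h, T.orbit u s := fun h hh => by
    have e1 : T.orbit (∫ s in (0 : ℝ)..t, T.orbit u s) h =
        ∫ s in (0 : ℝ)..t, T.toFun h.toNNReal (T.orbit u s) :=
      ((T.toFun h.toNNReal).intervalIntegral_comp_comm (hint 0 t)).symm
    have e2 : (∫ s in (0 : ℝ)..t, T.toFun h.toNNReal (T.orbit u s)) =
        ∫ s in (0 : ℝ)..t, T.orbit u (s + h) := by
      refine intervalIntegral.integral_congr fun s hs => ?_
      rw [Set.uIcc_of_le ht] at hs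
      rw [add_comm s h, T.orbit_add u hh hs.1]
    rw [e1, e2, intervalIntegral.integral_comp_add_right (T.orbit u) h, zero_add,
      intervalIntegral.integral_interval_sub_left (hint _ _) (hint _ _)]
  rw [hasGeneratorAt_iff, neg_sub]
  have d1 : HasDerivAt (fun h => ∫ s in (0 : ℝ)..(t + h), T.orbit u s) (T.orbit u t) 0 := by
    have := (T.hasDerivAt_integral_orbit u (t + 0)).comp_const_add t 0
    simpa using this
  have d2 : HasDerivAt (fun h => ∫ s in (0 : ℝ)..h, T.orbit u s) u 0 := by
    simpa using T.hasDerivAt_integral_orbit u 0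
  exact (d1.sub d2).hasDerivWithinAt.congr (fun h hh => key h (le_of_lt hh)) (key 0 le_rfl)

theorem tendsto_inv_smul_integral_orbit (T : C0Semigroup H) (u : H) :
    Tendsto (fun t : ℝ => t⁻¹ • ∫ s in (0 : ℝ)..t, T.orbit u s) (𝓝[>] 0) (𝓝 u) := by
  have h := (T.hasDerivAt_integral_orbit u 0).hasDerivWithinAt (s := Set.Ioi 0)
  rw [hasDerivWithinAt_iff_tendsto_slope' Set.self_notMem_Ioi, orbit_zero] at h
  refine h.congr fun t => ?_
  simp [slope_def_module]

theorem dense_generator_domain (T : C0Semigroup H) : Dense (T.generator.domain : Set H) := by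
  intro u
  refine mem_closure_of_tendsto (T.tendsto_inv_smul_integral_orbit u) ?_
  filter_upwards [self_mem_nhdsWithin] with t ht
  rw [← Complex.coe_smul]
  exact T.generator.domain.smul_mem _
    (mem_generator_domain (T.hasGeneratorAt_integral_orbit u (le_of_lt ht)))

/-- The fundamental theorem of calculus needs only right derivatives of a continuous function. The
formula then upgrades the right derivative of the orbit to a two-sided one at positive times, and it
passes to limits when the generator is shown to be closed. -/
theorem HasGeneratorAt.sub_orbit_eq_integral {T : C0Semigroup H} {u v : H}
    (h : T.HasGeneratorAt u v) {t : ℝ} (ht : 0 ≤ t) :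
    u - T.orbit u t = ∫ s in (0 : ℝ)..t, T.orbit v s := by
  have := intervalIntegral.integral_eq_sub_of_hasDeriv_right_of_le ht
    (T.continuous_orbit u).continuousOn
    (fun s hs => h.hasDerivWithinAt_orbit hs.1.le)
    ((T.continuous_orbit v).neg.intervalIntegrable 0 t)
  rw [orbit_zero, intervalIntegral.integral_neg] at this
  rw [← neg_sub, ← this, neg_neg]

theorem HasGeneratorAt.hasDerivAt_orbit {T : C0Semigroup H} {u v : H}
    (h : T.HasGeneratorAt u v) {s : ℝ} (hs : 0 < s) :
    HasDerivAt (T.orbit u) (-T.orbit v s) s := by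
  refine ((T.hasDerivAt_integral_orbit v s).const_sub u).congr_of_eventuallyEq ?_
  filter_upwards [lt_mem_nhds hs] with r hr
  rw [← h.sub_orbit_eq_integral hr.le, sub_sub_cancel]

theorem hasGeneratorAt_of_sub_orbit_eq_integral {T : C0Semigroup H} {u v : H}
    (h : ∀ t ∈ Set.Icc (0 : ℝ) 1, u - T.orbit u t = ∫ s in (0 : ℝ)..t, T.orbit v s) :
    T.HasGeneratorAt u v := by
  rw [hasGeneratorAt_iff]
  have d := (T.hasDerivAt_integral_orbit v 0).const_sub u
  rw [orbit_zero] at d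
  refine d.hasDerivWithinAt.congr_of_eventuallyEq ?_ (by simp)
  filter_upwards [Ioo_mem_nhdsGT (zero_lt_one (α := ℝ))] with t ht
  rw [← h t ⟨ht.1.le, ht.2.le⟩, sub_sub_cancel]

theorem exists_norm_le (T : C0Semigroup H) : ∃ M : ℝ, ∀ t : Set.Icc (0 : ℝ≥0) 1,
    ‖T.toFun t‖ ≤ M := by
  refine banach_steinhaus fun u => ?_
  obtain ⟨C, hC⟩ := (isCompact_Icc (a := (0 : ℝ≥0)) (b := 1)).exists_bound_of_continuousOn
    (T.strongly_continuous u).continuousOn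
  exact ⟨C, fun t => hC t t.2⟩

theorem isClosed_generator (T : C0Semigroup H) : T.generator.IsClosed := by
  -- The uniform bound on `[0, 1]` from Banach–Steinhaus lets the integral formula pass to the limit
  -- along a sequence in the graph.
  obtain ⟨M, hM⟩ := T.exists_norm_le
  refine IsSeqClosed.isClosed fun x p hx hp => ?_
  obtain ⟨u, v⟩ := p
  have hgen : ∀ n, T.HasGeneratorAt (x n).1 (x n).2 := fun n => by
    obtain ⟨y, h1, h2⟩ := (LinearPMap.mem_graph_iff _).1 (hx n)
    rw [← h1, ← h2]
    exact T.generator_spec y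
  have hu : Tendsto (fun n => (x n).1) atTop (𝓝 u) := (continuous_fst.tendsto _).comp hp
  have hv : Tendsto (fun n => (x n).2) atTop (𝓝 v) := (continuous_snd.tendsto _).comp hp
  have huv : T.HasGeneratorAt u v := by
    refine hasGeneratorAt_of_sub_orbit_eq_integral fun t ht => ?_
    have l1 : Tendsto (fun n => (x n).1 - T.orbit (x n).1 t) atTop (𝓝 (u - T.orbit u t)) :=
      hu.sub (((T.toFun t.toNNReal).continuous.tendsto u).comp hu)
    refine tendsto_nhds_unique l1 ?_
    simp only [fun n => (hgen n).sub_orbit_eq_integral ht.1]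
    rw [tendsto_iff_norm_sub_tendsto_zero] at hv ⊢
    refine squeeze_zero (fun _ => norm_nonneg _) (fun n => ?_)
      (by simpa only [mul_zero] using hv.const_mul (M * |t - 0|))
    rw [← intervalIntegral.integral_sub ((T.continuous_orbit _).intervalIntegrable _ _)
      ((T.continuous_orbit _).intervalIntegrable _ _)]
    refine (intervalIntegral.norm_integral_le_of_norm_le_const fun s hs => ?_).trans
      (mul_right_comm M ‖(x n).2 - v‖ |t - 0|).le
    rw [Set.uIoc_of_le ht.1] at hs
    rw [orbit, orbit, ← _root_.map_sub]
    exact (T.toFun s.toNNReal).le_of_opNorm_le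
      (hM ⟨s.toNNReal, zero_le, by simpa using hs.2.trans ht.2⟩) _
  exact (LinearPMap.mem_graph_iff _).2
    ⟨⟨u, mem_generator_domain huv⟩, rfl, generator_apply_eq huv _⟩

/-- This avoids the adjoint semigroup. With `v_t` the average of the orbit of `v` over `[0, t]`, one
has `(S*v, v_t) = (v, S v_t) = (v, v - T(t)v) / t`, whose real part is nonnegative for small `t`,
and `v_t → v`. -/
theorem adjoint_generator_isAccretive {T : C0Semigroup H}
    (h : ∀ᶠ t in 𝓝[>] (0 : ℝ), ∀ u, (inner ℂ u (T.orbit u t)).re ≤ ‖u‖ ^ 2) :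
    T.generator.adjoint.IsAccretive := by
  intro v
  have hl : Tendsto (fun t : ℝ => (inner ℂ (T.generator.adjoint v)
      (t⁻¹ • ∫ s in (0 : ℝ)..t, T.orbit (v : H) s)).re) (𝓝[>] 0)
      (𝓝 (inner ℂ (T.generator.adjoint v) (v : H)).re) :=
    (Complex.continuous_re.tendsto _).comp
      (tendsto_const_nhds.inner (T.tendsto_inv_smul_integral_orbit (v : H)))
  rw [← inner_conj_symm, Complex.conj_re]
  refine ge_of_tendsto hl ?_
  filter_upwards [self_mem_nhdsWithin, h] with t ht hc
  have hg := T.hasGeneratorAt_integral_orbit (v : H) (le_of_lt ht)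
  have e := LinearPMap.adjoint_isFormalAdjoint T.dense_generator_domain v
    ⟨_, mem_generator_domain hg⟩
  rw [generator_apply_eq hg] at e
  change inner ℂ (T.generator.adjoint v) (∫ s in (0 : ℝ)..t, T.orbit (v : H) s) = _ at e
  rw [← Complex.coe_smul, inner_smul_right, e, Complex.re_ofReal_mul, inner_sub_right,
    Complex.sub_re, inner_self_eq_norm_sq_to_K]
  refine mul_nonneg (inv_nonneg.2 (le_of_lt ht)) (sub_nonneg.2 ?_)
  refine (hc v).trans (le_of_eq ?_)
  rw [← Complex.ofReal_re (‖(v : H)‖ ^ 2), Complex.ofReal_pow]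
  rfl

end C0Semigroup

/-! ### Scaling of numerical ranges -/

section Scaling

variable {H : Type*} [NormedAddCommGroup H] [InnerProductSpace ℂ H]

theorem LinearPMap.exists_mem_numericalRange (A : H →ₗ.[ℂ] H) {u : A.domain} (hu : (u : H) ≠ 0) :
    ∃ w ∈ A.numericalRange, inner ℂ (u : H) (A u) = ((‖(u : H)‖ ^ 2 : ℝ) : ℂ) * w := by
  have hp : 0 < ‖(u : H)‖ := norm_pos_iff.2 hu
  have hp' : (‖(u : H)‖ : ℂ) ≠ 0 := by exact_mod_cast hp.ne'
  refine ⟨_, ⟨((‖(u : H)‖⁻¹ : ℝ) : ℂ) • u, ?_, rfl⟩, ?_⟩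
  · rw [Submodule.coe_smul, norm_smul, Complex.norm_real, norm_inv, norm_norm,
      inv_mul_cancel₀ hp.ne']
  · rw [A.map_smul, Submodule.coe_smul, inner_smul_left, inner_smul_right, Complex.conj_ofReal]
    push_cast
    field_simp

theorem LinearPMap.abs_im_inner_le {A : H →ₗ.[ℂ] H} {α : ℝ} (h0 : 0 ≤ α) (h1 : α < Real.pi / 2)
    (h : A.numericalRange ⊆ sectorSet α) (u : A.domain) :
    |(inner ℂ (u : H) (A u)).im| ≤ Real.tan α * (inner ℂ (u : H) (A u)).re := by
  rcases eq_or_ne (u : H) 0 with hu | hu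
  · simp [hu]
  obtain ⟨w, hw, e⟩ := A.exists_mem_numericalRange hu
  have := ((mem_sectorSet_iff h0 h1 w).1 (h hw)).2
  rw [e, Complex.re_ofReal_mul, Complex.im_ofReal_mul, abs_mul, abs_of_nonneg (by positivity)]
  nlinarith [mul_le_mul_of_nonneg_left this (sq_nonneg ‖(u : H)‖)]

/-- Polarization: adding the upper bound at `x + y` to the lower bound at `x - y`, and vice versa,
cancels the diagonal imaginary parts and the mixed real parts. -/
theorem LinearPMap.abs_im_inner_add_inner_le {A : H →ₗ.[ℂ] H} {k : ℝ}
    (h : ∀ u : A.domain, |(inner ℂ (u : H) (A u)).im| ≤ k * (inner ℂ (u : H) (A u)).re)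
    (x y : A.domain) :
    |(inner ℂ (x : H) (A y) + inner ℂ (y : H) (A x)).im| ≤
      k * ((inner ℂ (x : H) (A x)).re + (inner ℂ (y : H) (A y)).re) := by
  have h1 := abs_le.1 (h (x + y))
  have h2 := abs_le.1 (h (x - y))
  simp only [A.map_add, A.map_sub, Submodule.coe_add, Submodule.coe_sub, inner_add_left,
    inner_add_right, inner_sub_left, inner_sub_right, Complex.add_im, Complex.sub_im,
    Complex.add_re, Complex.sub_re] at h1 h2
  rw [abs_le, Complex.add_im]
  constructor <;> linarith

theorem ContinuousLinearMap.exists_mem_numericalRange (A : H →L[ℂ] H) {u : H} (hu : u ≠ 0) :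
    ∃ w ∈ A.numericalRange, inner ℂ u (A u) = ((‖u‖ ^ 2 : ℝ) : ℂ) * w := by
  have hp : 0 < ‖u‖ := norm_pos_iff.2 hu
  have hp' : (‖u‖ : ℂ) ≠ 0 := by exact_mod_cast hp.ne'
  refine ⟨_, ⟨((‖u‖⁻¹ : ℝ) : ℂ) • u, ?_, rfl⟩, ?_⟩
  · rw [norm_smul, Complex.norm_real, norm_inv, norm_norm, inv_mul_cancel₀ hp.ne']
  · rw [map_smul, inner_smul_left, inner_smul_right, Complex.conj_ofReal]
    push_cast
    field_simp

theorem ContinuousLinearMap.re_inner_le_of_numericalRange_subset {A : H →L[ℂ] H} {α : ℝ}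
    (h : A.numericalRange ⊆ omegaSet α) (u : H) : (inner ℂ u (A u)).re ≤ ‖u‖ ^ 2 := by
  rcases eq_or_ne u 0 with rfl | hu
  · simp
  obtain ⟨w, hw, e⟩ := A.exists_mem_numericalRange hu
  have := (Complex.re_le_norm w).trans (norm_le_one_of_mem_omegaSet (h hw))
  rw [e, Complex.re_ofReal_mul]
  exact mul_le_of_le_one_right (sq_nonneg _) this

theorem re_inner_self_eq_norm_sq (u : H) : (inner ℂ u u).re = ‖u‖ ^ 2 :=
  inner_self_eq_norm_sq (𝕜 := ℂ) u

theorem im_inner_self_eq_zero (u : H) : (inner ℂ u u).im = 0 :=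
  inner_self_im (𝕜 := ℂ) u

theorem ContinuousLinearMap.abs_im_inner_sub_le {A : H →L[ℂ] H} {α : ℝ}
    (h0 : 0 ≤ α) (h1 : α < Real.pi / 2) (h : A.numericalRange ⊆ omegaSet α) (u : H) :
    |(inner ℂ u (u - A u)).im| ≤ Real.tan α * (inner ℂ u (u - A u)).re := by
  rcases eq_or_ne u 0 with rfl | hu
  · simp
  obtain ⟨w, hw, e⟩ := A.exists_mem_numericalRange hu
  have := abs_im_le_of_mem_omegaSet h0 h1 (h hw)
  rw [inner_sub_right, Complex.sub_im, Complex.sub_re, re_inner_self_eq_norm_sq,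
    im_inner_self_eq_zero, zero_sub, abs_neg, e, Complex.re_ofReal_mul, Complex.im_ofReal_mul,
    abs_mul, abs_of_nonneg (by positivity)]
  nlinarith [mul_le_mul_of_nonneg_left this (sq_nonneg ‖u‖)]

end Scaling

/-! ### Semigroups whose generators are accretive or sectorial -/

namespace C0Semigroup

variable {H : Type*} [NormedAddCommGroup H] [InnerProductSpace ℂ H]

theorem HasGeneratorAt.inner_tendsto {T : C0Semigroup H} {u v : H} (h : T.HasGeneratorAt u v) :
    Tendsto (fun t : ℝ≥0 => ((t⁻¹ : ℝ≥0) : ℂ) * inner ℂ u (u - T.toFun t u)) (𝓝[>] 0)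
      (𝓝 (inner ℂ u v)) := by
  have h' : Tendsto (fun t : ℝ≥0 => inner ℂ u (((t : ℝ) : ℂ)⁻¹ • (u - T.toFun t u))) (𝓝[>] 0)
      (𝓝 (inner ℂ u v)) := Tendsto.inner tendsto_const_nhds h
  refine h'.congr fun t => ?_
  rw [inner_smul_right]
  norm_cast

theorem HasGeneratorAt.re_inner_nonneg {T : C0Semigroup H} {u v : H} (h : T.HasGeneratorAt u v)
    (hT : ∀ᶠ t : ℝ≥0 in 𝓝[>] 0, (inner ℂ u (T.toFun t u)).re ≤ ‖u‖ ^ 2) :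
    0 ≤ (inner ℂ u v).re := by
  refine ge_of_tendsto ((Complex.continuous_re.tendsto _).comp h.inner_tendsto) ?_
  filter_upwards [hT] with t ht
  have e : ((t⁻¹ : ℝ≥0) : ℂ) = (((t⁻¹ : ℝ≥0) : ℝ) : ℂ) := rfl
  rw [Function.comp_apply, e, Complex.re_ofReal_mul, inner_sub_right, Complex.sub_re,
    re_inner_self_eq_norm_sq]
  exact mul_nonneg (NNReal.coe_nonneg _) (sub_nonneg.2 ht)

theorem HasGeneratorAt.abs_im_inner_le {T : C0Semigroup H} {u v : H} (h : T.HasGeneratorAt u v)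
    {k : ℝ} (hT : ∀ᶠ t : ℝ≥0 in 𝓝[>] 0,
      |(inner ℂ u (u - T.toFun t u)).im| ≤ k * (inner ℂ u (u - T.toFun t u)).re) :
    |(inner ℂ u v).im| ≤ k * (inner ℂ u v).re := by
  refine le_of_tendsto_of_tendsto
    ((Complex.continuous_im.abs.tendsto _).comp h.inner_tendsto)
    (((Complex.continuous_re.tendsto _).comp h.inner_tendsto).const_mul k) ?_
  filter_upwards [hT] with t ht
  have e : ((t⁻¹ : ℝ≥0) : ℂ) = (((t⁻¹ : ℝ≥0) : ℝ) : ℂ) := rfl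
  simp only [Function.comp_apply]
  rw [e, Complex.re_ofReal_mul, Complex.im_ofReal_mul, abs_mul, abs_of_nonneg (NNReal.coe_nonneg _)]
  nlinarith [mul_le_mul_of_nonneg_left ht (NNReal.coe_nonneg t⁻¹)]

theorem orbit_mem_domain {T : C0Semigroup H} (u : T.generator.domain) (s : ℝ) :
    T.orbit u s ∈ T.generator.domain :=
  mem_generator_domain ((T.generator_spec u).map s.toNNReal)

theorem generator_orbit {T : C0Semigroup H} (u : T.generator.domain) (s : ℝ) :
    T.generator ⟨T.orbit u s, orbit_mem_domain u s⟩ = T.orbit (T.generator u) s :=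
  generator_apply_eq ((T.generator_spec u).map s.toNNReal) _

variable [CompleteSpace H]

theorem generator_isMSectorial {T : C0Semigroup H} {α : ℝ} (h0 : 0 ≤ α) (h1 : α < Real.pi / 2)
    (h : ∀ᶠ t : ℝ≥0 in 𝓝 0, (T.toFun t).numericalRange ⊆ omegaSet α) :
    T.generator.IsMSectorial α := by
  have h' := h.filter_mono (nhdsWithin_le_nhds (s := Set.Ioi 0))
  have hacc : T.generator.IsAccretive := fun u =>
    (T.generator_spec u).re_inner_nonneg
      (h'.mono fun _ ht => ContinuousLinearMap.re_inner_le_of_numericalRange_subset ht _)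
  refine ⟨⟨hacc, T.dense_generator_domain, T.isClosed_generator,
    adjoint_generator_isAccretive ?_⟩, ?_⟩
  · have hr : Tendsto Real.toNNReal (𝓝[>] 0) (𝓝 0) := by
      have := (continuous_real_toNNReal.tendsto (0 : ℝ)).mono_left
        (nhdsWithin_le_nhds (s := Set.Ioi 0))
      rwa [Real.toNNReal_zero] at this
    exact (hr.eventually h).mono fun _ ht =>
      ContinuousLinearMap.re_inner_le_of_numericalRange_subset ht
  · rintro _ ⟨u, -, rfl⟩
    exact (mem_sectorSet_iff h0 h1 _).2 ⟨hacc u, (T.generator_spec u).abs_im_inner_le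
      (h'.mono fun _ ht => ContinuousLinearMap.abs_im_inner_sub_le h0 h1 ht _)⟩

/-- On the domain, `‖T(s)u‖²` has derivative `-2 Re (S T(s)u, T(s)u) ≤ 0`; density does the rest. -/
theorem norm_le_one_of_isAccretive {T : C0Semigroup H} (h : T.generator.IsAccretive) (t : ℝ≥0) :
    ‖T.toFun t‖ ≤ 1 := by
  refine ContinuousLinearMap.opNorm_le_bound _ zero_le_one fun u => ?_
  rw [one_mul]
  refine T.dense_generator_domain.induction (P := fun u => ‖T.toFun t u‖ ≤ ‖u‖) ?_
    (isClosed_le (by fun_prop) (by fun_prop)) u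
  intro u hu
  lift u to T.generator.domain using hu
  have hd : ∀ s, 0 < s → HasDerivAt (fun s => ‖T.orbit u s‖ ^ 2)
      (-(2 * (inner ℂ (T.orbit u s) (T.orbit (T.generator u) s)).re)) s := fun s hs => by
    have d := (T.generator_spec u).hasDerivAt_orbit hs
    have := Complex.reCLM.hasFDerivAt.comp_hasDerivAt s (d.inner ℂ d)
    simp only [Function.comp_def, Complex.reCLM_apply, re_inner_self_eq_norm_sq] at this
    refine this.congr_deriv ?_
    rw [inner_neg_left, inner_neg_right, ← inner_conj_symm (T.orbit (T.generator u) s),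
      Complex.add_re, Complex.neg_re, Complex.neg_re, Complex.conj_re]
    ring
  have hanti : AntitoneOn (fun s => ‖T.orbit u s‖ ^ 2) (Set.Ici 0) := by
    refine antitoneOn_of_hasDerivWithinAt_nonpos (convex_Ici 0)
      ((T.continuous_orbit _).norm.pow 2).continuousOn
      (fun s hs => (hd s (by simpa using hs)).hasDerivWithinAt) fun s _ => ?_
    have := h ⟨_, orbit_mem_domain u s⟩
    rw [generator_orbit] at this
    linarith
  have := hanti (Set.mem_Ici.2 le_rfl) (Set.mem_Ici.2 t.2) t.2
  simp only [orbit_zero, NNReal.val_eq_coe, orbit_coe] at this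
  exact (sq_le_sq₀ (norm_nonneg _) (norm_nonneg _)).1 this

/-- The central estimate, obtained by running the orbit forwards from `0` and backwards from `t`
until both meet at `t / 2`. -/
theorem two_mul_abs_im_inner_le {T : C0Semigroup H} {k : ℝ}
    (h : ∀ u : T.generator.domain, |(inner ℂ (u : H) (T.generator u)).im| ≤
      k * (inner ℂ (u : H) (T.generator u)).re) (t : ℝ≥0) (u : H) :
    2 * |(inner ℂ u (T.toFun t u)).im| ≤ k * (‖u‖ ^ 2 - ‖T.toFun t u‖ ^ 2) := by
  refine T.dense_generator_domain.induction (P := fun u =>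
    2 * |(inner ℂ u (T.toFun t u)).im| ≤ k * (‖u‖ ^ 2 - ‖T.toFun t u‖ ^ 2)) ?_
    (isClosed_le (by fun_prop) (by fun_prop)) u
  intro u hu
  lift u to T.generator.domain using hu
  set r := (t : ℝ)
  have hr : 0 ≤ r := NNReal.coe_nonneg t
  set φ := T.orbit u
  set ψ := T.orbit (T.generator u)
  have hφ : ∀ s, 0 < s → HasDerivAt φ (-ψ s) s := fun s hs =>
    (T.generator_spec u).hasDerivAt_orbit hs
  have hφ' : ∀ s, s < r → HasDerivAt (fun s => φ (r - s)) (ψ (r - s)) s := fun s hs => by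
    have := (hφ (r - s) (sub_pos.2 hs)).scomp s ((hasDerivAt_id s).const_sub r)
    simpa [Function.comp_def] using this
  have hc : Continuous φ := T.continuous_orbit _
  have hform : ∀ s, |(inner ℂ (φ (r - s)) (ψ s) + inner ℂ (φ s) (ψ (r - s))).im| ≤
      k * ((inner ℂ (φ (r - s)) (ψ (r - s))).re + (inner ℂ (φ s) (ψ s)).re) := fun s => by
    have := LinearPMap.abs_im_inner_add_inner_le h ⟨_, orbit_mem_domain u (r - s)⟩
      ⟨_, orbit_mem_domain u s⟩
    rwa [generator_orbit, generator_orbit] at this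
  -- The sign `ε = ±1` produces both halves of the absolute value. `G` vanishes at `r / 2`, where
  -- both vectors coincide, and its derivative is nonpositive by `hform`.
  have main : ∀ ε : ℝ, |ε| = 1 →
      0 ≤ k * (‖(u : H)‖ ^ 2 - ‖φ r‖ ^ 2) + ε * (2 * (inner ℂ (φ r) (u : H)).im) := by
    intro ε hε
    set G : ℝ → ℝ := fun s => k * ((inner ℂ (φ s) (φ s)).re -
      (inner ℂ (φ (r - s)) (φ (r - s))).re) + ε * (2 * (inner ℂ (φ (r - s)) (φ s)).im) with hG
    have hGc : Continuous G := by fun_prop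
    have hGd : ∀ s ∈ interior (Set.Icc 0 (r / 2)), HasDerivWithinAt G
        (-(2 * k) * ((inner ℂ (φ (r - s)) (ψ (r - s))).re + (inner ℂ (φ s) (ψ s)).re) -
          2 * ε * (inner ℂ (φ (r - s)) (ψ s) + inner ℂ (φ s) (ψ (r - s))).im)
        (interior (Set.Icc 0 (r / 2))) s := by
      intro s hs
      rw [interior_Icc] at hs
      have d1 := hφ s hs.1
      have d2 := hφ' s (by linarith [hs.1, hs.2])
      have e1 := Complex.reCLM.hasFDerivAt.comp_hasDerivAt s (d1.inner ℂ d1)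
      have e2 := Complex.reCLM.hasFDerivAt.comp_hasDerivAt s (d2.inner ℂ d2)
      have e3 := Complex.imCLM.hasFDerivAt.comp_hasDerivAt s (d2.inner ℂ d1)
      refine (((e1.sub e2).const_mul k).add ((e3.const_mul 2).const_mul ε)).hasDerivWithinAt.congr_deriv
        ?_
      simp only [Complex.reCLM_apply, Complex.imCLM_apply, inner_neg_left, inner_neg_right]
      rw [← inner_conj_symm (ψ s) (φ s), ← inner_conj_symm (ψ (r - s)) (φ (r - s)),
        ← inner_conj_symm (ψ (r - s)) (φ s)]
      simp only [Complex.add_re, Complex.neg_re, Complex.conj_re, Complex.add_im, Complex.neg_im,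
        Complex.conj_im]
      ring
    have hanti : AntitoneOn G (Set.Icc 0 (r / 2)) := by
      refine antitoneOn_of_hasDerivWithinAt_nonpos (convex_Icc _ _) hGc.continuousOn hGd
        fun s _ => ?_
      have h1 := hform s
      have h2 := neg_le_abs (ε * (inner ℂ (φ (r - s)) (ψ s) + inner ℂ (φ s) (ψ (r - s))).im)
      rw [abs_mul, hε, one_mul] at h2
      linarith
    have hle := hanti (Set.left_mem_Icc.2 (by linarith)) (Set.right_mem_Icc.2 (by linarith))
      (by linarith : (0 : ℝ) ≤ r / 2)
    have hmid : G (r / 2) = 0 := by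
      simp only [hG, sub_half, im_inner_self_eq_zero]
      ring
    have hφ0 : φ 0 = u := T.orbit_zero _
    have hG0 : G 0 = k * (‖(u : H)‖ ^ 2 - ‖φ r‖ ^ 2) + ε * (2 * (inner ℂ (φ r) (u : H)).im) := by
      simp only [hG, sub_zero, hφ0, re_inner_self_eq_norm_sq]
    rwa [hmid, hG0] at hle
  have hφr : φ r = T.toFun t u := T.orbit_coe _ t
  have m1 := main 1 (by simp)
  have m2 := main (-1) (by simp)
  rw [hφr] at m1 m2
  have e : (inner ℂ (T.toFun t u) (u : H)).im = -(inner ℂ (u : H) (T.toFun t u)).im := by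
    rw [← inner_conj_symm, Complex.conj_im]
  rw [e] at m1 m2
  rcases abs_cases (inner ℂ (u : H) (T.toFun t u)).im with ⟨h, -⟩ | ⟨h, -⟩ <;> rw [h] <;> linarith

theorem numericalRange_subset_lensSet {T : C0Semigroup H} {α : ℝ} (h0 : 0 ≤ α)
    (h1 : α < Real.pi / 2) (h : T.generator.IsMSectorial α) (t : ℝ≥0) :
    (T.toFun t).numericalRange ⊆ lensSet α := by
  rintro _ ⟨u, hu, rfl⟩
  have ht : 0 ≤ Real.tan α := Real.tan_nonneg_of_nonneg_of_le_pi_div_two h0 h1.le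
  have hle : ‖inner ℂ u (T.toFun t u)‖ ≤ ‖T.toFun t u‖ := by
    simpa [hu] using norm_inner_le_norm (𝕜 := ℂ) u (T.toFun t u)
  have hT : ‖T.toFun t u‖ ≤ 1 := by
    simpa [hu] using (T.toFun t).le_of_opNorm_le
      (norm_le_one_of_isAccretive h.mAccretive.accretive t) u
  refine ⟨hle.trans hT, ?_⟩
  have key := two_mul_abs_im_inner_le
    (LinearPMap.abs_im_inner_le h0 h1 h.numericalRange_subset) t u
  rw [hu, one_pow] at key
  have := pow_le_pow_left₀ (norm_nonneg _) hle 2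
  nlinarith [mul_le_mul_of_nonneg_left this ht]

theorem numericalRange_subset_omegaSet {T : C0Semigroup H} {α : ℝ} (h0 : 0 ≤ α)
    (h1 : α < Real.pi / 2) (h : T.generator.IsMSectorial α) (t : ℝ≥0) :
    (T.toFun t).numericalRange ⊆ omegaSet α := by
  -- The lens bound holds at every time, in particular at `t / 2`; squaring turns it into the bound
  -- by `Ω(α)` at `t`.
  rw [← add_halves t, T.map_add]
  exact ContinuousLinearMap.numericalRange_comp_self_subset_omegaSet h0 h1
    (numericalRange_subset_lensSet h0 h1 h _)

end C0Semigroup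

/-! ### Uniformly continuous semigroups -/

section Exponential

variable {H : Type*} [NormedAddCommGroup H] [InnerProductSpace ℂ H] [CompleteSpace H]

/-- The semigroup `exp(-tB)` of a bounded operator `B`. -/
noncomputable def ContinuousLinearMap.expSemigroup (B : H →L[ℂ] H) : C0Semigroup H where
  toFun t := NormedSpace.exp ((t : ℝ) • (-B))
  map_zero := by
    simp only [NNReal.coe_zero, zero_smul, NormedSpace.exp_zero]
    rfl
  map_add s t := by
    let _ : NormedAlgebra ℚ (H →L[ℂ] H) := .restrictScalars ℚ ℂ _
    rw [NNReal.coe_add, add_smul, NormedSpace.exp_add_of_commute]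
    · rfl
    · exact ((Commute.refl (-B)).smul_left _).smul_right _
  strongly_continuous u := by
    let _ : NormedAlgebra ℚ (H →L[ℂ] H) := .restrictScalars ℚ ℂ _
    have : Continuous fun t : ℝ≥0 => NormedSpace.exp ((t : ℝ) • (-B)) :=
      NormedSpace.exp_continuous.comp (by fun_prop)
    fun_prop

namespace ContinuousLinearMap

theorem expSemigroup_apply (B : H →L[ℂ] H) (t : ℝ≥0) :
    B.expSemigroup.toFun t = NormedSpace.exp ((t : ℝ) • (-B)) :=
  rfl

theorem expSemigroup_hasGeneratorAt (B : H →L[ℂ] H) (u : H) :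
    B.expSemigroup.HasGeneratorAt u (B u) := by
  rw [C0Semigroup.hasGeneratorAt_iff]
  have h := hasDerivAt_exp_smul_const (-B) (0 : ℝ)
  rw [zero_smul, NormedSpace.exp_zero, one_mul] at h
  have h' : HasDerivAt (fun t : ℝ => NormedSpace.exp (t • (-B)) u) (-B u) 0 :=
    ((ContinuousLinearMap.apply ℂ H u).restrictScalars ℝ).hasFDerivAt.comp_hasDerivAt (0 : ℝ) h
  refine h'.hasDerivWithinAt.congr (fun t ht => ?_) ?_
  · rw [C0Semigroup.orbit, expSemigroup_apply, Real.coe_toNNReal _ (le_of_lt ht)]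
  · simp

theorem norm_expSemigroup_le_one {B : H →L[ℂ] H} (hB : ∀ u, 0 ≤ (inner ℂ u (B u)).re) (t : ℝ≥0) :
    ‖B.expSemigroup.toFun t‖ ≤ 1 := by
  refine C0Semigroup.norm_le_one_of_isAccretive (fun u => ?_) t
  rw [show B.expSemigroup.generator u = B u from
    C0Semigroup.generator_apply_eq (B.expSemigroup_hasGeneratorAt _) u.2]
  exact hB _

/-- The path `f s = exp(-(t - s)C) exp(-sB)` joins the two operators. By commutativity its
derivative is `f s` applied to `C - B`, and each `f s` is a contraction. -/
theorem norm_expSemigroup_sub_le {B C : H →L[ℂ] H} (hB : ∀ u, 0 ≤ (inner ℂ u (B u)).re)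
    (hC : ∀ u, 0 ≤ (inner ℂ u (C u)).re) (hBC : Commute B C) (t : ℝ≥0) (u : H) :
    ‖B.expSemigroup.toFun t u - C.expSemigroup.toFun t u‖ ≤ t * ‖B u - C u‖ := by
  let _ : NormedAlgebra ℚ (H →L[ℂ] H) := .restrictScalars ℚ ℂ _
  set D := -B - -C with hD
  set f : ℝ → H →L[ℂ] H := fun s => NormedSpace.exp ((t : ℝ) • (-C)) * NormedSpace.exp (s • D)
    with hf
  have hCD : Commute (-C) D := (hBC.symm.neg_left.neg_right).sub_right (Commute.refl _)
  have hBC' : Commute (-C) (-B) := hBC.symm.neg_left.neg_right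
  have hf' : ∀ s : ℝ, f s = NormedSpace.exp (((t : ℝ) - s) • (-C)) *
      NormedSpace.exp (s • (-B)) := fun s => by
    rw [hf]
    simp only
    rw [← NormedSpace.exp_add_of_commute ((hCD.smul_left _).smul_right _),
      ← NormedSpace.exp_add_of_commute ((hBC'.smul_left _).smul_right _), hD]
    congr 1
    module
  have hder : ∀ s, HasDerivAt (fun s => f s u) (f s (D u)) s := fun s => by
    have h := (hasDerivAt_exp_smul_const D s).const_mul (NormedSpace.exp ((t : ℝ) • (-C)))
    exact ((ContinuousLinearMap.apply ℂ H u).restrictScalars ℝ).hasFDerivAt.comp_hasDerivAt s h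
  have hbound : ∀ s ∈ Set.Ico (0 : ℝ) t, ‖f s (D u)‖ ≤ ‖B u - C u‖ := fun s hs => by
    have h1 := norm_expSemigroup_le_one hC ⟨(t : ℝ) - s, sub_nonneg.2 hs.2.le⟩
    have h2 := norm_expSemigroup_le_one hB ⟨s, hs.1⟩
    have h3 : ‖f s‖ ≤ 1 := by
      rw [hf']
      exact (norm_mul_le _ _).trans (mul_le_one₀ h1 (norm_nonneg _) h2)
    refine ((f s).le_of_opNorm_le h3 _).trans (le_of_eq ?_)
    rw [one_mul, hD, ← norm_neg]
    congr 1
    simp only [sub_apply, neg_apply]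
    abel
  have := norm_image_sub_le_of_norm_deriv_le_segment' (a := (0 : ℝ)) (b := t)
    (fun s _ => (hder s).hasDerivWithinAt) hbound t ⟨t.2, le_rfl⟩
  rw [hf' t, hf' 0] at this
  simpa [expSemigroup_apply, mul_comm] using this

end ContinuousLinearMap

end Exponential

/-! ### Resolvents of `m`-accretive operators -/

section Resolvent

variable {H : Type*} [NormedAddCommGroup H] [InnerProductSpace ℂ H] {S : H →ₗ.[ℂ] H}

/-- Cauchy–Schwarz for the pairing of `u` with `l u + S u`, whose real part is at least `l ‖u‖²`. -/
theorem LinearPMap.IsAccretive.mul_norm_le (h : S.IsAccretive) (l : ℝ) (u : S.domain) :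
    l * ‖(u : H)‖ ≤ ‖(l : ℂ) • (u : H) + S u‖ := by
  rcases eq_or_ne (u : H) 0 with hu | hu
  · simp [hu]
  have hp : 0 < ‖(u : H)‖ := norm_pos_iff.2 hu
  have h1 := (Complex.re_le_norm _).trans
    (norm_inner_le_norm (𝕜 := ℂ) (u : H) ((l : ℂ) • (u : H) + S u))
  rw [inner_add_right, inner_smul_right, Complex.add_re, Complex.re_ofReal_mul,
    re_inner_self_eq_norm_sq] at h1
  have h2 := h u
  refine le_of_mul_le_mul_left ?_ hp
  linarith

variable [CompleteSpace H]

namespace LinearPMap.IsMAccretive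

theorem surjective_smul_add (h : S.IsMAccretive) {l : ℝ} (hl : 0 < l) (x : H) :
    ∃ u : S.domain, (l : ℂ) • (u : H) + S u = x := by
  set L : S.domain →ₗ[ℂ] H := (l : ℂ) • S.domain.subtype + S.toFun with hL
  have hLu : ∀ u, L u = (l : ℂ) • (u : H) + S u := fun u => rfl
  -- The lower bound makes preimages of a convergent sequence Cauchy, and closedness of `S`
  -- identifies the limit.
  have hcl : _root_.IsClosed (LinearMap.range L : Set H) := by
    refine IsSeqClosed.isClosed fun y z hy hyz => ?_
    choose u hu using hy
    have hcau : CauchySeq fun n => (u n : H) := by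
      rw [Metric.cauchySeq_iff']
      intro ε hε
      obtain ⟨N, hN⟩ := Metric.cauchySeq_iff'.1 hyz.cauchySeq (l * ε) (mul_pos hl hε)
      refine ⟨N, fun n hn => ?_⟩
      have h1 := h.accretive.mul_norm_le l (u n - u N)
      rw [← hLu, _root_.map_sub, hu, hu, ← dist_eq_norm, Submodule.coe_sub, ← dist_eq_norm] at h1
      exact lt_of_mul_lt_mul_left (h1.trans_lt (hN n hn)) hl.le
    obtain ⟨v, hv⟩ := cauchySeq_tendsto_of_complete hcau
    have hS : Tendsto (fun n => S (u n)) atTop (𝓝 (z - (l : ℂ) • v)) := by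
      refine (hyz.sub (hv.const_smul (l : ℂ))).congr fun n => ?_
      rw [← hu, hLu, add_sub_cancel_left]
    have hmem : (v, z - (l : ℂ) • v) ∈ (S.graph : Set (H × H)) :=
      _root_.IsClosed.mem_of_tendsto h.closed (hv.prodMk_nhds hS) (Eventually.of_forall fun n =>
        S.mem_graph (u n))
    obtain ⟨w, hw1, hw2⟩ := (LinearPMap.mem_graph_iff _).1 hmem
    exact ⟨w, by rw [hLu, hw2, hw1, add_sub_cancel]⟩
  -- A vector `v` orthogonal to the range lies in the domain of `S*` with `S*v = -l v`, so
  -- accretivity of `S*` forces `v = 0`.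
  have htop : LinearMap.range L = ⊤ := by
    have : CompleteSpace (LinearMap.range L) := hcl.completeSpace_coe
    rw [← Submodule.orthogonal_eq_bot_iff, Submodule.eq_bot_iff]
    intro v hv
    have hinner : ∀ u : S.domain, inner ℂ (-((l : ℂ) • v)) (u : H) = inner ℂ v (S u) := fun u => by
      have := (Submodule.mem_orthogonal' _ _).1 hv (L u) (LinearMap.mem_range_self _ _)
      rw [hLu, inner_add_right, inner_smul_right] at this
      rw [inner_neg_left, inner_smul_left, Complex.conj_ofReal]
      linear_combination -this
    have hdom : v ∈ S.adjoint.domain := S.mem_adjoint_domain_of_exists v ⟨_, hinner⟩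
    have h1 := h.adjoint_accretive ⟨v, hdom⟩
    rw [LinearPMap.adjoint_apply_eq h.dense_domain ⟨v, hdom⟩ hinner, inner_neg_right,
      inner_smul_right, Complex.neg_re, Complex.re_ofReal_mul, re_inner_self_eq_norm_sq] at h1
    have h2 : ‖v‖ ^ 2 ≤ 0 := by
      by_contra! h3
      linarith [mul_pos hl h3]
    simpa using h2
  exact LinearMap.range_eq_top.1 htop x

theorem exists_resolvent (h : S.IsMAccretive) {l : ℝ} (hl : 0 < l) :
    ∃ R : H →L[ℂ] H, (∀ x, l * ‖R x‖ ≤ ‖x‖) ∧ (∀ x, R x ∈ S.domain) ∧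
      ∀ u : S.domain, R ((l : ℂ) • (u : H) + S u) = u := by
  set L : S.domain →ₗ[ℂ] H := (l : ℂ) • S.domain.subtype + S.toFun with hL
  have hLu : ∀ u, L u = (l : ℂ) • (u : H) + S u := fun u => rfl
  have hinj : Function.Injective L := by
    rw [injective_iff_map_eq_zero]
    intro u hu
    have := h.accretive.mul_norm_le l u
    rw [← hLu, hu, norm_zero] at this
    have h0 : ‖(u : H)‖ ≤ 0 := by
      by_contra! h3
      linarith [mul_pos hl h3]
    simpa using h0
  set e := LinearEquiv.ofBijective L ⟨hinj, h.surjective_smul_add hl⟩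
  have hbound : ∀ x, l * ‖(e.symm x : H)‖ ≤ ‖x‖ := fun x => by
    have h1 := h.accretive.mul_norm_le l (e.symm x)
    rw [← hLu] at h1
    have h2 : L (e.symm x) = x := e.apply_symm_apply x
    rwa [h2] at h1
  refine ⟨(S.domain.subtype ∘ₗ (e.symm : H →ₗ[ℂ] S.domain)).mkContinuous l⁻¹ fun x => ?_,
    hbound, fun x => (e.symm x).2, fun u => ?_⟩
  · rw [inv_mul_eq_div, le_div_iff₀' hl]
    exact hbound x
  · exact congrArg Subtype.val (e.symm_apply_apply u)

/-- The resolvent `(l + S)⁻¹`. -/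
noncomputable def resolvent (h : S.IsMAccretive) {l : ℝ} (hl : 0 < l) : H →L[ℂ] H :=
  (h.exists_resolvent hl).choose

variable (h : S.IsMAccretive) {l : ℝ} (hl : 0 < l)

theorem mul_norm_resolvent_le (x : H) : l * ‖h.resolvent hl x‖ ≤ ‖x‖ :=
  (h.exists_resolvent hl).choose_spec.1 x

theorem resolvent_mem (x : H) : h.resolvent hl x ∈ S.domain :=
  (h.exists_resolvent hl).choose_spec.2.1 x

theorem resolvent_smul_add (u : S.domain) :
    h.resolvent hl ((l : ℂ) • (u : H) + S u) = u :=
  (h.exists_resolvent hl).choose_spec.2.2 u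

theorem smul_resolvent_add (x : H) :
    (l : ℂ) • h.resolvent hl x + S ⟨h.resolvent hl x, h.resolvent_mem hl x⟩ = x := by
  obtain ⟨u, rfl⟩ := h.surjective_smul_add hl x
  have e : (⟨_, h.resolvent_mem hl ((l : ℂ) • (u : H) + S u)⟩ : S.domain) = u :=
    Subtype.ext (h.resolvent_smul_add hl u)
  rw [e, h.resolvent_smul_add hl u]

/-- The resolvent identity: apply `(l + S)⁻¹` to `(l + S) R_m x = x + (l - m) R_m x`. -/
theorem resolvent_comp_resolvent {m : ℝ} (hm : 0 < m) (x : H) :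
    h.resolvent hl x + ((l : ℂ) - m) • h.resolvent hl (h.resolvent hm x) = h.resolvent hm x := by
  have h1 := h.resolvent_smul_add hl ⟨_, h.resolvent_mem hm x⟩
  have h2 := h.smul_resolvent_add hm x
  rw [← eq_sub_iff_add_eq'] at h2
  rw [h2, show (l : ℂ) • h.resolvent hm x + (x - (m : ℂ) • h.resolvent hm x) =
    x + ((l : ℂ) - m) • h.resolvent hm x by module, _root_.map_add, _root_.map_smul] at h1
  exact h1

theorem commute_resolvent {m : ℝ} (hm : 0 < m) :
    Commute (h.resolvent hl) (h.resolvent hm) := by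
  rcases eq_or_ne l m with rfl | hne
  · exact Commute.refl _
  refine ContinuousLinearMap.ext fun x => ?_
  have h1 := h.resolvent_comp_resolvent hl hm x
  have h2 := h.resolvent_comp_resolvent hm hl x
  have hne' : (l : ℂ) - m ≠ 0 := sub_ne_zero.2 (by exact_mod_cast hne)
  refine smul_right_injective H hne' ?_
  change ((l : ℂ) - m) • h.resolvent hl (h.resolvent hm x) =
    ((l : ℂ) - m) • h.resolvent hm (h.resolvent hl x)
  rw [← eq_sub_iff_add_eq'] at h1 h2
  rw [h1, ← neg_sub (m : ℂ), neg_smul, h2, neg_sub]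

/-- The Yosida approximation `S (1 + l⁻¹ S)⁻¹ = l - l² (l + S)⁻¹`. -/
noncomputable def yosida : H →L[ℂ] H :=
  (l : ℂ) • ContinuousLinearMap.id ℂ H - ((l : ℂ) ^ 2) • h.resolvent hl

theorem yosida_apply (x : H) :
    h.yosida hl x = (l : ℂ) • x - ((l : ℂ) ^ 2) • h.resolvent hl x :=
  rfl

/-- Since `l R` is a contraction, `Re (l R x, x) ≤ ‖x‖²`. -/
theorem re_inner_yosida_nonneg (x : H) : 0 ≤ (inner ℂ x (h.yosida hl x)).re := by
  rw [yosida_apply, inner_sub_right, inner_smul_right, inner_smul_right, ← Complex.ofReal_pow,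
    Complex.sub_re, Complex.re_ofReal_mul, Complex.re_ofReal_mul, re_inner_self_eq_norm_sq]
  have h1 := (Complex.re_le_norm _).trans (norm_inner_le_norm (𝕜 := ℂ) x (h.resolvent hl x))
  have h2 := mul_le_mul_of_nonneg_left (h.mul_norm_resolvent_le hl x) (norm_nonneg x)
  have h3 : l * (inner ℂ x (h.resolvent hl x)).re ≤ ‖x‖ ^ 2 := by
    nlinarith [mul_le_mul_of_nonneg_left h1 hl.le]
  nlinarith [mul_le_mul_of_nonneg_left h3 hl.le]

theorem commute_yosida {m : ℝ} (hm : 0 < m) : Commute (h.yosida hl) (h.yosida hm) := by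
  have h1 := h.commute_resolvent hl hm
  have hid : ∀ A : H →L[ℂ] H, Commute (ContinuousLinearMap.id ℂ H) A := Commute.one_left
  have hid' : ∀ A : H →L[ℂ] H, Commute A (ContinuousLinearMap.id ℂ H) := Commute.one_right
  refine Commute.sub_left (Commute.sub_right ?_ ?_) (Commute.sub_right ?_ ?_)
  · exact ((hid _).smul_left _).smul_right _
  · exact ((hid _).smul_left _).smul_right _
  · exact ((hid' _).smul_left _).smul_right _
  · exact (h1.smul_left _).smul_right _

theorem yosida_apply_domain (u : S.domain) :
    h.yosida hl u = (l : ℂ) • h.resolvent hl (S u) := by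
  have h1 := h.resolvent_smul_add hl u
  rw [_root_.map_add, _root_.map_smul, ← eq_sub_iff_add_eq'] at h1
  rw [yosida_apply, h1]
  module

/-- On the domain, `l R v - v = -R (S v)` is of order `1 / l`; the contractions `l R` carry the
limit over to the closure. The shift `n + 1` keeps the parameter positive. -/
theorem tendsto_smul_resolvent (x : H) :
    Tendsto (fun n : ℕ => ((n + 1 : ℝ) : ℂ) • h.resolvent (Nat.cast_add_one_pos n) x) atTop
      (𝓝 x) := by
  rw [Metric.tendsto_atTop]
  intro ε hε
  obtain ⟨v, hv, hxv⟩ := h.dense_domain.exists_dist_lt x (by positivity : 0 < ε / 4)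
  lift v to S.domain using hv
  obtain ⟨N, hN⟩ := exists_nat_gt (‖S v‖ / (ε / 4))
  refine ⟨N, fun n hn => ?_⟩
  have hl : 0 < (n + 1 : ℝ) := Nat.cast_add_one_pos n
  set R := h.resolvent hl with hR
  set l : ℝ := n + 1 with hln
  have hb : ∀ y, ‖(l : ℂ) • R y‖ ≤ ‖y‖ := fun y => by
    rw [norm_smul, Complex.norm_real, Real.norm_of_nonneg hl.le]
    exact h.mul_norm_resolvent_le hl y
  have e : (l : ℂ) • R v - v = -R (S v) := by
    have h1 := h.resolvent_smul_add hl v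
    rw [_root_.map_add, _root_.map_smul, ← hR] at h1
    nth_rewrite 2 [← h1]
    abel
  have hRS : ‖R (S v)‖ ≤ ε / 4 := by
    have h1 := h.mul_norm_resolvent_le hl (S v)
    rw [div_lt_iff₀ (by positivity)] at hN
    have h2 : (N : ℝ) ≤ l := by
      have : (N : ℝ) ≤ n := by exact_mod_cast hn
      linarith
    have h3 := mul_le_mul_of_nonneg_right h2 (by positivity : 0 ≤ ε / 4)
    exact le_of_mul_le_mul_left ((h1.trans hN.le).trans h3) hl
  have e2 : (l : ℂ) • R x - x = (l : ℂ) • R (x - v) + ((l : ℂ) • R v - v) - (x - v) := by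
    rw [_root_.map_sub]
    module
  rw [dist_eq_norm] at hxv ⊢
  rw [e2, e]
  have h1 := norm_sub_le ((l : ℂ) • R (x - v) + -R (S v)) (x - v)
  have h2 := norm_add_le ((l : ℂ) • R (x - v)) (-R (S v))
  rw [norm_neg] at h2
  linarith [hb (x - v)]

theorem tendsto_yosida (u : S.domain) :
    Tendsto (fun n : ℕ => h.yosida (Nat.cast_add_one_pos (α := ℝ) n) u) atTop (𝓝 (S u)) := by
  simp only [yosida_apply_domain]
  exact h.tendsto_smul_resolvent (S u)

end LinearPMap.IsMAccretive

end Resolvent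

/-! ### Generation of semigroups -/

namespace C0Semigroup

variable {H : Type*} [NormedAddCommGroup H] [InnerProductSpace ℂ H] [CompleteSpace H]

/-- The estimate `hsub` makes the contraction semigroups `E n` Cauchy on the dense domain, uniformly
for bounded times, and contractivity extends strong convergence to all vectors. -/
theorem exists_limit {S : H →ₗ.[ℂ] H} (hS : Dense (S.domain : Set H)) (E : ℕ → C0Semigroup H)
    (b : ℕ → H → H) (hE : ∀ n t, ‖(E n).toFun t‖ ≤ 1)
    (hsub : ∀ m n t u, ‖(E m).toFun t u - (E n).toFun t u‖ ≤ t * ‖b m u - b n u‖)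
    (hb : ∀ u : S.domain, Tendsto (fun n => b n u) atTop (𝓝 (S u)))
    (hgen : ∀ n u, (E n).HasGeneratorAt u (b n u)) :
    ∃ T : C0Semigroup H, (∀ t, ‖T.toFun t‖ ≤ 1) ∧
      ∀ u : S.domain, T.HasGeneratorAt (u : H) (S u) := by
  have hE' : ∀ n t u, ‖(E n).toFun t u‖ ≤ ‖u‖ := fun n t u => by
    simpa using ((E n).toFun t).le_of_opNorm_le (hE n t) u
  have hcau : ∀ t u, CauchySeq fun n => (E n).toFun t u := by
    intro t u
    rw [Metric.cauchySeq_iff']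
    intro ε hε
    obtain ⟨v, hv, huv⟩ := hS.exists_dist_lt u (by positivity : 0 < ε / 4)
    lift v to S.domain using hv
    have ht : 0 < (t : ℝ) + 1 := by positivity
    obtain ⟨N, hN⟩ := Metric.cauchySeq_iff'.1 (hb v).cauchySeq (ε / 4 / (t + 1)) (by positivity)
    refine ⟨N, fun n hn => ?_⟩
    have h1 := hN n hn
    rw [dist_eq_norm, lt_div_iff₀ ht] at h1
    rw [dist_eq_norm] at huv ⊢
    have h2 := hsub n N t v
    have h3 : (E n).toFun t u - (E N).toFun t u = (E n).toFun t (u - v) - (E N).toFun t (u - v) +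
        ((E n).toFun t v - (E N).toFun t v) := by
      rw [_root_.map_sub, _root_.map_sub]
      abel
    rw [h3]
    have h4 := norm_add_le ((E n).toFun t (u - v) - (E N).toFun t (u - v))
      ((E n).toFun t v - (E N).toFun t v)
    have h5 := norm_sub_le ((E n).toFun t (u - v)) ((E N).toFun t (u - v))
    nlinarith [hE' n t (u - v), hE' N t (u - v), norm_nonneg (b n v - b N v)]
  choose L hL using fun t u => cauchySeq_tendsto_of_complete (hcau t u)
  set T : ℝ≥0 → H →L[ℂ] H := fun t =>
    continuousLinearMapOfTendsto (fun n => (E n).toFun t) (tendsto_pi_nhds.2 (hL t))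
  have hT : ∀ t u, Tendsto (fun n => (E n).toFun t u) atTop (𝓝 (T t u)) := hL
  have hT1 : ∀ t u, ‖T t u‖ ≤ ‖u‖ := fun t u =>
    le_of_tendsto (hT t u).norm (Eventually.of_forall fun n => hE' n t u)
  have hdiff : ∀ n t (u : S.domain), ‖(E n).toFun t u - T t u‖ ≤ t * ‖b n u - S u‖ :=
    fun n t u => le_of_tendsto_of_tendsto ((tendsto_const_nhds.sub (hT t u)).norm)
      ((tendsto_const_nhds.sub (hb u)).norm.const_mul _) (Eventually.of_forall fun m => hsub n m t u)
  have hcont_dom : ∀ u : S.domain, Continuous fun t => T t u := by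
    refine fun u => continuous_of_locally_uniform_approx_of_continuousAt fun t U hU => ?_
    obtain ⟨ε, hε, hεU⟩ := Metric.mem_uniformity_dist.1 hU
    have ht : 0 < (t : ℝ) + 1 := by positivity
    obtain ⟨n, hn⟩ := ((Metric.tendsto_nhds.1 (hb u)) (ε / (t + 1)) (by positivity)).exists
    refine ⟨Set.Iio (t + 1), Iio_mem_nhds (by simp), fun t => (E n).toFun t u,
      ((E n).strongly_continuous _).continuousAt, fun s hs => hεU ?_⟩
    rw [dist_eq_norm, lt_div_iff₀ ht] at hn
    rw [dist_comm, dist_eq_norm]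
    have hs' : (s : ℝ) ≤ t + 1 := by exact_mod_cast le_of_lt hs
    nlinarith [hdiff n s u, mul_le_mul_of_nonneg_right hs' (norm_nonneg (b n u - S u))]
  refine ⟨⟨T, ?_, fun s t => ?_, fun u => ?_⟩, fun t => ?_, fun u => ?_⟩
  · refine ContinuousLinearMap.ext fun u => tendsto_nhds_unique (hT 0 u) ?_
    simp only [fun n => (E n).map_zero]
    exact tendsto_const_nhds
  · refine ContinuousLinearMap.ext fun u => tendsto_nhds_unique (hT (s + t) u) ?_
    simp only [fun n => (E n).map_add, ContinuousLinearMap.comp_apply]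
    have h1 : Tendsto (fun n => (E n).toFun s ((E n).toFun t u - T t u)) atTop (𝓝 0) := by
      refine squeeze_zero_norm (fun n => hE' n s _) ?_
      exact tendsto_iff_norm_sub_tendsto_zero.1 (hT t u)
    have h2 := h1.add (hT s (T t u))
    simpa only [_root_.map_sub, sub_add_cancel, zero_add] using h2
  · refine continuous_of_uniform_approx_of_continuous fun U hU => ?_
    obtain ⟨ε, hε, hεU⟩ := Metric.mem_uniformity_dist.1 hU
    obtain ⟨v, hv, huv⟩ := hS.exists_dist_lt u hε
    refine ⟨fun t => T t v, hcont_dom ⟨v, hv⟩, fun t => hεU ?_⟩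
    rw [dist_eq_norm, ← _root_.map_sub]
    rw [dist_eq_norm] at huv
    exact (hT1 t _).trans_lt huv
  · exact (T t).opNorm_le_bound zero_le_one fun u => by simpa using hT1 t u
  · change Tendsto (fun t : ℝ≥0 => ((t : ℝ) : ℂ)⁻¹ • ((u : H) - T t u)) (𝓝[>] 0) (𝓝 (S u))
    rw [Metric.tendsto_nhds]
    intro ε hε
    obtain ⟨n, hn⟩ := ((Metric.tendsto_nhds.1 (hb u)) (ε / 4) (by positivity)).exists
    have hg : Tendsto (fun t : ℝ≥0 => ((t : ℝ) : ℂ)⁻¹ • ((u : H) - (E n).toFun t u)) (𝓝[>] 0)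
      (𝓝 (b n u)) := hgen n u
    filter_upwards [(Metric.tendsto_nhds.1 hg) (ε / 4) (by positivity), self_mem_nhdsWithin]
      with t h1 ht
    have ht' : 0 < (t : ℝ) := NNReal.coe_pos.2 ht
    rw [dist_eq_norm] at h1 hn ⊢
    -- This bound does not depend on `t`, so `n` can be fixed before `t` tends to `0`.
    have h2 : ‖((t : ℝ) : ℂ)⁻¹ • ((E n).toFun t u - T t u)‖ ≤ ‖b n u - S u‖ := by
      rw [norm_smul, norm_inv, Complex.norm_real, Real.norm_of_nonneg ht'.le,
        inv_mul_le_iff₀ ht']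
      exact hdiff n t u
    have e : ((t : ℝ) : ℂ)⁻¹ • ((u : H) - T t u) - S u =
        ((t : ℝ) : ℂ)⁻¹ • ((E n).toFun t u - T t u) +
        (((t : ℝ) : ℂ)⁻¹ • ((u : H) - (E n).toFun t u) - b n u) + (b n u - S u) := by
      module
    rw [e]
    refine (norm_add₃_le).trans_lt ?_
    linarith

/-- The Hille–Yosida theorem for `m`-accretive operators in a Hilbert space. -/
theorem exists_generator_eq {S : H →ₗ.[ℂ] H} (h : S.IsMAccretive) :
    ∃ T : C0Semigroup H, T.generator = S := by
  have hl : ∀ n : ℕ, 0 < (n + 1 : ℝ) := fun n => Nat.cast_add_one_pos n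
  obtain ⟨T, hT, hTS⟩ := exists_limit h.dense_domain (fun n => (h.yosida (hl n)).expSemigroup)
    (fun n => h.yosida (hl n))
    (fun n t => ContinuousLinearMap.norm_expSemigroup_le_one (h.re_inner_yosida_nonneg (hl n)) t)
    (fun m n t u => ContinuousLinearMap.norm_expSemigroup_sub_le
      (h.re_inner_yosida_nonneg (hl m)) (h.re_inner_yosida_nonneg (hl n))
      (h.commute_yosida (hl m) (hl n)) t u)
    h.tendsto_yosida (fun n u => ContinuousLinearMap.expSemigroup_hasGeneratorAt _ u)
  have hacc : T.generator.IsAccretive := fun u =>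
    (T.generator_spec u).re_inner_nonneg (Eventually.of_forall fun t => by
      have h1 := (Complex.re_le_norm _).trans (norm_inner_le_norm (𝕜 := ℂ) (u : H) (T.toFun t u))
      have h2 := (T.toFun t).le_of_opNorm_le (hT t) u
      nlinarith [mul_le_mul_of_nonneg_left h2 (norm_nonneg (u : H))])
  have hle : S ≤ T.generator := by
    refine ⟨fun u hu => mem_generator_domain (hTS ⟨u, hu⟩), fun x y hxy => ?_⟩
    obtain ⟨y, hy⟩ := y
    obtain rfl : (x : H) = y := hxy
    exact (generator_apply_eq (hTS x) _).symm
  -- An m-accretive operator has no proper accretive extension: `1 + S` is already onto, while `1 +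
  -- T.generator` is injective.
  have hge : T.generator.domain ≤ S.domain := by
    intro u hu
    obtain ⟨v, hv⟩ := h.surjective_smul_add one_pos (u + T.generator ⟨u, hu⟩)
    have hv' := hle.1 v.2
    have e : T.generator ⟨v, hv'⟩ = S v := generator_apply_eq (hTS v) _
    have h1 := hacc.mul_norm_le 1 (⟨u, hu⟩ - ⟨v, hv'⟩)
    rw [T.generator.map_sub, e, Submodule.coe_sub] at h1
    simp only [Complex.ofReal_one, one_smul, one_mul] at h1 hv
    rw [show u - (v : H) + (T.generator ⟨u, hu⟩ - S v) =
      (u + T.generator ⟨u, hu⟩) - ((v : H) + S v) by abel, hv, sub_self, norm_zero] at h1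
    rw [sub_eq_zero.1 (norm_le_zero_iff.1 h1)]
    exact v.2
  exact ⟨T, (LinearPMap.eq_of_le_of_domain_eq hle (le_antisymm hle.1 hge)).symm⟩

end C0Semigroup

theorem theorem3p1 {H : Type*} [NormedAddCommGroup H] [InnerProductSpace ℂ H] [CompleteSpace H]
    (α : ℝ) (hα0 : 0 ≤ α) (hα1 : α < Real.pi / 2) :
    (∀ S : H →ₗ.[ℂ] H, S.IsMSectorial α →
      (∃ T : C0Semigroup H, T.generator = S) ∧
      ∀ T : C0Semigroup H, T.generator = S → ∀ t : ℝ≥0,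
        (T.toFun t).numericalRange ⊆ omegaSet α ∧
        (T.toFun t).IsQuasiSectorialContraction α) ∧
    (∀ T : C0Semigroup H,
      (∀ᶠ t : ℝ≥0 in 𝓝 0, (T.toFun t).numericalRange ⊆ omegaSet α) →
        T.generator.IsMSectorial α) := by
  refine ⟨fun S hS => ⟨C0Semigroup.exists_generator_eq hS.mAccretive, ?_⟩,
    fun T hT => C0Semigroup.generator_isMSectorial hα0 hα1 hT⟩
  rintro T rfl t
  have h := C0Semigroup.numericalRange_subset_omegaSet hα0 hα1 hS t
  exact ⟨h, C0Semigroup.norm_le_one_of_isAccretive hS.mAccretive.accretive t,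
    h.trans (omegaSet_subset_quasiSectorSet hα0 hα1)⟩
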